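/- Let $d\ge 1$. For $i=1,\dots,d$ let $\alpha_i\in(1,2)$ and let $d_{i,+},d_{i,-}\ge 0$ be diffusion coefficients with $d_{i,+}+d_{i,-}>0$. Put $$\mu:=\max_{1\le i\le d}\frac{|d_{i,+}-d_{i,-}|}{d_{i,+}+d_{i,-}}\left|\tan\left(\frac{\alpha_i}{2}\pi\right)\right|.$$ For a box $\prod_{i=1}^d(a_i,b_i)$ with $a_i<b_i$, a final time $T>0$, grid sizes $n_1,\dots,n_d\ge 1$ and a number $M\ge 1$ of time steps, let $n=n_1\cdots n_d$, $h_i=(b_i-a_i)/(n_i+1)$, $\nu=M/T$ (the reciprocal of the time step $T/M$), $\widetilde v_{i,\pm}=d_{i,\pm}/h_i^{\alpha_i}$, $n_i^-=\prod_{j<i}n_j$ and $n_i^+=\prod_{j>i}n_j$. Let $\widetilde g_k^{(\alpha)}=(-1)^k\binom{\alpha}{k}$ for $k\ge 0$, and let $\widetilde L_m^{(\alpha)}\in\mathbb R^{m\times m}$ be the shifted Grünwald matrix whose $(j,k)$ entry is $-\widetilde g^{(\alpha)}_{j-k+1}$ if $k\le j+1$ and $0$ otherwise. The coefficient matrix of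 the first-order scheme (backward Euler in time, shifted Grünwald in space) for the Riemann–Liouville space fractional diffusion equation is $$\widetilde A_n=\nu I_n+\sum_{i=1}^d\left(\widetilde v_{i,+}\widetilde W_i+\widetilde v_{i,-}\widetilde W_i^{\top}\right),\qquad \widetilde W_i=I_{n_i^-}\otimes \widetilde L_{n_i}^{(\alpha_i)}\otimes I_{n_i^+}.$$ For a square matrix $Z$ let $\mathcal H(Z)=(Z+Z^\top)/2$, and for a symmetric Toeplitz matrix $T_m$ with first column $(t_1,\dots,t_m)^\top$ let $\tau(T_m)=T_m-H_m$, where $H_m$ is the Hankel matrix with first column $(t_3,\dots,t_m,0,0)^\top$ and last column $(0,0,t_m,\dots,t_3)^\top$ ($H_m=0$ for $m\le 2$). The multilevel Tau preconditioner is $$\widetilde P_n=\nu I_n+\sum_{i=1}^d(\widetilde v_{i,+}+\widetilde v_{i,-})\, I_{n_i^-}\otimes\tau\left(\mathcal H\left(\widetilde L_{n_i}^{(\alpha_i)}\right)\right)\otimes I_{n_i^+}.$$ Finally let $Y_n=Y_{n_1}\otimes\cdots\otimes Y_{n_d}$, where $Y_m$ is the $m\times m$ anti-identity matrix ($[Y_m]_{j,k}=1$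 if $j+k=m+1$, and $0$ otherwise). **Theorem.** There is a real number $\varepsilon$ with $0\le\varepsilon\le\mu$, and with $\varepsilon<\mu$ if $\mu>0$, which depends only on $d$ and on the numbers $\alpha_i,d_{i,+},d_{i,-}$, such that for all boxes, all $T>0$, all $n_1,\dots,n_d\ge1$ and all $M\ge 1$ the matrix $\widetilde P_n$ is invertible and all (complex) eigenvalues of $\widetilde P_n^{-1}Y_n\widetilde A_n$ are real and lie in $$\left(-\tfrac32(1+\varepsilon),-\tfrac12\right)\cup\left(\tfrac12,\tfrac32(1+\varepsilon)\right).$$ -/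

import Mathlib

noncomputable section

namespace FracDiff

open scoped Matrix

/-- The anti-identity matrix: with indices `1, …, m` the `(j, k)` entry is `1` iff `j + k = m + 1`. -/
def antiIdentity (m : ℕ) : Matrix (Fin m) (Fin m) ℝ :=
  Matrix.of fun j k => if (j : ℕ) + (k : ℕ) + 1 = m then 1 else 0

/-- The symmetric part `(Z + Zᵀ) / 2` of a real square matrix. -/
def symmPart {ι : Type*} (Z : Matrix ι ι ℝ) : Matrix ι ι ℝ :=
  (1 / 2 : ℝ) • (Z + Zᵀ)

/-- The first column of `T`, read as a sequence (index starting at `0`) and continued by zero. -/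
def firstColumn {m : ℕ} (T : Matrix (Fin m) (Fin m) ℝ) (s : ℕ) : ℝ :=
  if h : s < m then T ⟨s, h⟩ ⟨0, by omega⟩ else 0

/-- For a Toeplitz matrix `T` with first column `(t₁, …, t_m)`, the Hankel matrix with first
column `(t₃, …, t_m, 0, 0)` and last column `(0, 0, t_m, …, t₃)`. -/
def tauHankel {m : ℕ} (T : Matrix (Fin m) (Fin m) ℝ) : Matrix (Fin m) (Fin m) ℝ :=
  Matrix.of fun j k =>
    firstColumn T ((j : ℕ) + (k : ℕ) + 2) + firstColumn T (2 * m - ((j : ℕ) + (k : ℕ)))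

/-- The `τ`-matrix approximation of a symmetric Toeplitz matrix `T`. -/
def tau {m : ℕ} (T : Matrix (Fin m) (Fin m) ℝ) : Matrix (Fin m) (Fin m) ℝ :=
  T - tauHankel T

/-- The Grünwald coefficients `(-1)^k / k! * α (α - 1) ⋯ (α - k + 1)`. -/
def grunwaldCoeff (α : ℝ) (k : ℕ) : ℝ :=
  (-1) ^ k / (k.factorial : ℝ) * ∏ j ∈ Finset.range k, (α - (j : ℝ))

/-- The shifted Grünwald matrix: the `(j, k)` entry is `-g_{j-k+1}` if `k ≤ j + 1`, and `0` above
the first superdiagonal. -/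
def grunwaldMatrix (α : ℝ) (m : ℕ) : Matrix (Fin m) (Fin m) ℝ :=
  Matrix.of fun j k =>
    if (k : ℕ) ≤ (j : ℕ) + 1 then -grunwaldCoeff α ((j : ℕ) + 1 - (k : ℕ)) else 0

/-- The `d`-fold Kronecker product `B₁ ⊗ ⋯ ⊗ B_d`. Rows and columns are indexed by multi-indices
(the usual numbering by `1, …, n₁ ⋯ n_d` is their lexicographic enumeration). -/
def kron {d : ℕ} {n : Fin d → ℕ} (B : ∀ i, Matrix (Fin (n i)) (Fin (n i)) ℝ) :
    Matrix (∀ i, Fin (n i)) (∀ i, Fin (n i)) ℝ :=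
  Matrix.of fun p q => ∏ i, B i (p i) (q i)

/-- `I ⊗ ⋯ ⊗ I ⊗ B ⊗ I ⊗ ⋯ ⊗ I` with `B` in position `i`. -/
def kronAt {d : ℕ} {n : Fin d → ℕ} (i : Fin d) (B : Matrix (Fin (n i)) (Fin (n i)) ℝ) :
    Matrix (∀ i, Fin (n i)) (∀ i, Fin (n i)) ℝ :=
  kron (Function.update (fun _ => 1) i B)

/-- The multilevel anti-identity `Y_{n₁} ⊗ ⋯ ⊗ Y_{n_d}`. -/
def multiAntiIdentity {d : ℕ} (n : Fin d → ℕ) : Matrix (∀ i, Fin (n i)) (∀ i, Fin (n i)) ℝ :=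
  kron fun i => antiIdentity (n i)

/-- The data of the fractional diffusion equation on `∏ (a_i, b_i) × (0, T]`. -/
structure Problem (d : ℕ) where
  /-- fractional orders -/
  α : Fin d → ℝ
  /-- left diffusion coefficients -/
  dPlus : Fin d → ℝ
  /-- right diffusion coefficients -/
  dMinus : Fin d → ℝ
  /-- left endpoints -/
  a : Fin d → ℝ
  /-- right endpoints -/
  b : Fin d → ℝ
  /-- final time -/
  T : ℝ

namespace Problem

variable {d : ℕ} (p : Problem d)

/-- The mesh size `h_i = (b_i - a_i) / (n_i + 1)`. -/
def h (n : Fin d → ℕ) (i : Fin d) : ℝ := (p.b i - p.a i) / ((n i : ℝ) + 1)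

/-- The time step `T / M`. -/
def timeStep (M : ℕ) : ℝ := p.T / (M : ℝ)

/-- `ν`, the reciprocal of the time step. -/
def nu (M : ℕ) : ℝ := 1 / p.timeStep M

/-- `d_{i,+} / h_i ^ α_i`. -/
def vPlus (n : Fin d → ℕ) (i : Fin d) : ℝ := p.dPlus i / p.h n i ^ p.α i

/-- `d_{i,-} / h_i ^ α_i`. -/
def vMinus (n : Fin d → ℕ) (i : Fin d) : ℝ := p.dMinus i / p.h n i ^ p.α i

/-- The coefficient matrix of the first-order scheme (backward Euler in time, shifted Grünwald
in space). -/
def coeffMatrix (n : Fin d → ℕ) (M : ℕ) : Matrix (∀ i, Fin (n i)) (∀ i, Fin (n i)) ℝ :=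
  p.nu M • 1 + ∑ i, (p.vPlus n i • kronAt i (grunwaldMatrix (p.α i) (n i)) +
    p.vMinus n i • (kronAt i (grunwaldMatrix (p.α i) (n i)))ᵀ)

/-- The multilevel Tau preconditioner of the first-order scheme. -/
def tauPrecond (n : Fin d → ℕ) (M : ℕ) : Matrix (∀ i, Fin (n i)) (∀ i, Fin (n i)) ℝ :=
  p.nu M • 1 + ∑ i, (p.vPlus n i + p.vMinus n i) •
    kronAt i (tau (symmPart (grunwaldMatrix (p.α i) (n i))))

end Problem

/-- `max_i |d_{i,+} - d_{i,-}| / (d_{i,+} + d_{i,-}) * |tan (α_i π / 2)|` (for `d ≥ 1`). -/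
def epsBound {d : ℕ} (α dPlus dMinus : Fin d → ℝ) : ℝ :=
  ⨆ i, |dPlus i - dMinus i| / (dPlus i + dMinus i) * |Real.tan (α i / 2 * Real.pi)|

end FracDiff

end

/-!
The flip `Y` commutes with the preconditioner `P` and intertwines the coefficient matrix `A` with
its transpose, so `Y A` is symmetric and the spectrum of `P⁻¹ Y A` is real. If `Y A x = l P x` and
`u = Y x`, then `A x = l P u`, whence `xᵀ A x = l xᵀ P u` and `uᵀ A x = l xᵀ P x`. The first
identity, the Cauchy-Schwarz inequality for `P` and `P / 2 < H(A)` bound `|l|` from below. For the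
second one, `H(A) < 3 P / 2` is combined with a Cauchy-Schwarz inequality for `A`: if the numerical
range of `A` lies in the sector `|Im z| ≤ μ Re z`, then
`(uᵀ A x)² ≤ (1 + μ²) (uᵀ A u) (xᵀ A x)`. Hence `ε = √(1 + μ²) - 1` works.

All ingredients reduce to one space dimension. The comparison of the symmetric part of a Grünwald
matrix with its `τ` approximation is diagonal dominance, since the Grünwald coefficients are
nonnegative and decreasing from the third on. The sector is that of the symbol `-z⁻¹ (1 - z)^α` on
the unit circle, whose argument is `(α - 2) arg (1 - z)` with `|arg (1 - z)| ≤ π / 2`.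
-/

noncomputable section

namespace FracDiff

open scoped Matrix

section Sectorial

variable {E F : Type*} [AddCommGroup E] [Module ℝ E] [AddCommGroup F] [Module ℝ F]

/-- A real bilinear form is sectorial with constant `μ` if the values of its sesquilinear extension
to the complexification lie in the sector `|Im z| ≤ μ Re z`: at `x + i y` the real part is
`B x x + B y y` and the imaginary part is `B x y - B y x`. -/
structure IsSectorial (B : LinearMap.BilinForm ℝ E) (μ : ℝ) : Prop where
  nonneg : ∀ x, 0 ≤ B x x
  abs_sub_le : ∀ x y, |B x y - B y x| ≤ μ * (B x x + B y y)

namespace IsSectorial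

variable {B C : LinearMap.BilinForm ℝ E} {μ κ : ℝ}

theorem of_isSymm (hB : B.IsSymm) (h0 : ∀ x, 0 ≤ B x x) (hμ : 0 ≤ μ) : IsSectorial B μ where
  nonneg := h0
  abs_sub_le x y := by
    rw [show B x y = B y x from hB.eq x y, sub_self, abs_zero]
    exact mul_nonneg hμ (add_nonneg (h0 x) (h0 y))

theorem add (hB : IsSectorial B μ) (hC : IsSectorial C μ) : IsSectorial (B + C) μ where
  nonneg x := add_nonneg (hB.nonneg x) (hC.nonneg x)
  abs_sub_le x y := by
    calc |(B + C) x y - (B + C) y x| = |(B x y - B y x) + (C x y - C y x)| := by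
          simp only [LinearMap.add_apply]; ring_nf
      _ ≤ |B x y - B y x| + |C x y - C y x| := abs_add_le _ _
      _ ≤ μ * (B x x + B y y) + μ * (C x x + C y y) :=
          add_le_add (hB.abs_sub_le x y) (hC.abs_sub_le x y)
      _ = μ * ((B + C) x x + (B + C) y y) := by simp only [LinearMap.add_apply]; ring

theorem zero : IsSectorial (0 : LinearMap.BilinForm ℝ E) μ where
  nonneg _ := le_rfl
  abs_sub_le _ _ := by simp

theorem sum {ι : Type*} (s : Finset ι) {B : ι → LinearMap.BilinForm ℝ E}
    (hB : ∀ i ∈ s, IsSectorial (B i) μ) : IsSectorial (∑ i ∈ s, B i) μ :=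
  Finset.sum_induction B (IsSectorial · μ) (fun _ _ => add) zero hB

theorem comp (hB : IsSectorial B μ) (f : F →ₗ[ℝ] E) : IsSectorial (B.compl₁₂ f f) μ where
  nonneg x := hB.nonneg (f x)
  abs_sub_le x y := hB.abs_sub_le (f x) (f y)

theorem smul_add_smul_flip (hB : IsSectorial B μ) {a b : ℝ} (hab : 0 ≤ a + b)
    (h : |a - b| * μ ≤ κ * (a + b)) : IsSectorial (a • B + b • B.flip) κ where
  nonneg x := by
    simpa [← add_mul] using mul_nonneg hab (hB.nonneg x)
  abs_sub_le x y := by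
    have hxy : 0 ≤ B x x + B y y := add_nonneg (hB.nonneg x) (hB.nonneg y)
    simp only [LinearMap.add_apply, LinearMap.smul_apply, LinearMap.BilinForm.flip_apply,
      smul_eq_mul]
    calc |a * B x y + b * B y x - (a * B y x + b * B x y)| = |a - b| * |B x y - B y x| := by
          rw [← abs_mul]; ring_nf
      _ ≤ |a - b| * (μ * (B x x + B y y)) := by gcongr; exact hB.abs_sub_le x y
      _ = |a - b| * μ * (B x x + B y y) := by ring
      _ ≤ κ * (a + b) * (B x x + B y y) := by gcongr
      _ = _ := by ring

theorem sq_sub_le (hB : IsSectorial B μ) (x y : E) :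
    (B x y - B y x) ^ 2 ≤ 4 * μ ^ 2 * (B x x * B y y) := by
  have hquad (k : ℝ) : 0 ≤ μ * B y y * (k * k) + -(B x y - B y x) * k + μ * B x x := by
    have h := (le_abs_self _).trans (hB.abs_sub_le x (k • y))
    simp only [map_smul, LinearMap.smul_apply, smul_eq_mul] at h
    linarith
  have := discrim_le_zero hquad
  rw [discrim] at this
  linarith

theorem sq_add_le (hB : IsSectorial B μ) (x y : E) :
    (B x y + B y x) ^ 2 ≤ 4 * (B x x * B y y) := by
  have hsymm : LinearMap.IsSymm (B + B.flip) := ⟨fun x y => add_comm _ _⟩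
  have hCS := LinearMap.BilinForm.apply_sq_le_of_symm (B + B.flip)
    (fun x => add_nonneg (hB.nonneg x) (hB.nonneg x)) hsymm x y
  simp only [LinearMap.add_apply, LinearMap.BilinForm.flip_apply] at hCS
  linarith

-- The skew part does not change when a multiple of `y` is added to `x`, so `sq_sub_le` may be
-- applied to the component of `x` orthogonal to `y` for the symmetric part of `B`.
theorem sq_sub_le_mul_sub_sq_add (hB : IsSectorial B μ) (x y : E) :
    (B x y - B y x) ^ 2 ≤ μ ^ 2 * (4 * (B x x * B y y) - (B x y + B y x) ^ 2) := by
  rcases (hB.nonneg y).eq_or_lt with hy | hy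
  · have hadd : (B x y + B y x) ^ 2 ≤ 0 := by simpa [← hy] using hB.sq_add_le x y
    have hsub : (B x y - B y x) ^ 2 ≤ 0 := by simpa [← hy] using hB.sq_sub_le x y
    rwa [hadd.antisymm (sq_nonneg _), ← hy, mul_zero, mul_zero, sub_zero, mul_zero]
  · have h := hB.sq_sub_le ((2 * B y y) • x - (B x y + B y x) • y) y
    simp only [map_sub, map_smul, LinearMap.sub_apply, LinearMap.smul_apply, smul_eq_mul] at h
    refine le_of_mul_le_mul_left (le_of_eq_of_le ?_ (h.trans_eq ?_))
      (show (0 : ℝ) < (2 * B y y) ^ 2 by positivity) <;> ring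

-- The constant is the square of the secant of the half-angle `arctan μ` of the sector.
theorem sq_apply_le (hB : IsSectorial B μ) (x y : E) :
    B x y ^ 2 ≤ (1 + μ ^ 2) * (B x x * B y y) := by
  set s := B x y + B y x with hs
  set t := B x y - B y x with ht
  set R := 4 * (B x x * B y y) - s ^ 2 with hR
  have hR0 : 0 ≤ R := sub_nonneg.2 (hB.sq_add_le x y)
  have ht_sq : t ^ 2 ≤ μ ^ 2 * R := hB.sq_sub_le_mul_sub_sq_add x y
  have hcross : 2 * s * t ≤ μ ^ 2 * s ^ 2 + R := by
    refine le_of_sq_le_sq ?_ (by positivity)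
    nlinarith [mul_le_mul_of_nonneg_left ht_sq (sq_nonneg s), sq_nonneg (μ ^ 2 * s ^ 2 - R)]
  have hsplit : B x y = (s + t) / 2 := by rw [hs, ht]; ring
  rw [hsplit]
  linarith [show R = 4 * (B x x * B y y) - s ^ 2 from hR,
    show 4 * ((s + t) / 2) ^ 2 = s ^ 2 + 2 * s * t + t ^ 2 by ring,
    show μ ^ 2 * R = μ ^ 2 * (4 * (B x x * B y y)) - μ ^ 2 * s ^ 2 by rw [hR]; ring]

theorem abs_apply_le (hB : IsSectorial B μ) {x y : E} (h : B y y = B x x) :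
    |B y x| ≤ √(1 + μ ^ 2) * B x x := by
  refine abs_le_of_sq_le_sq ?_ (mul_nonneg (Real.sqrt_nonneg _) (hB.nonneg x))
  rw [mul_pow, Real.sq_sqrt (by positivity), sq (B x x)]
  simpa only [h] using hB.sq_apply_le y x

end IsSectorial

end Sectorial

section Pencil

variable {ι : Type*} [Fintype ι]

theorem dotProduct_symmPart_mulVec (A : Matrix ι ι ℝ) (x : ι → ℝ) :
    x ⬝ᵥ symmPart A *ᵥ x = x ⬝ᵥ A *ᵥ x := by
  rw [symmPart, Matrix.smul_mulVec, Matrix.add_mulVec, dotProduct_smul, dotProduct_add,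
    Matrix.dotProduct_transpose_mulVec, smul_eq_mul]
  ring

theorem dotProduct_mulVec_lt_of_posDef_sub {A B : Matrix ι ι ℝ} (h : (B - A).PosDef) {x : ι → ℝ}
    (hx : x ≠ 0) : x ⬝ᵥ A *ᵥ x < x ⬝ᵥ B *ᵥ x := by
  simpa only [star_trivial, Matrix.sub_mulVec, dotProduct_sub, sub_pos]
    using h.dotProduct_mulVec_pos hx

variable [DecidableEq ι]

theorem dotProduct_mulVec_mulVec_of_mul_eq_mul {Y B C : Matrix ι ι ℝ} (hYY : Y * Y = 1)
    (hYt : Yᵀ = Y) (h : Y * B = C * Y) (x : ι → ℝ) :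
    (Y *ᵥ x) ⬝ᵥ C *ᵥ Y *ᵥ x = x ⬝ᵥ B *ᵥ x := by
  rw [Matrix.mulVec_mulVec, ← h, ← Matrix.mulVec_mulVec, ← Matrix.dotProduct_transpose_mulVec, hYt,
    Matrix.mulVec_mulVec, hYY, Matrix.one_mulVec, dotProduct_comm]

open scoped MatrixOrder in
theorem splits_charpoly_inv_mul {P N : Matrix ι ι ℝ} (hP : P.PosDef) (hN : N.IsHermitian) :
    (P⁻¹ * N).charpoly.Splits := by
  set S := CFC.sqrt P⁻¹
  have hSS : S * S = P⁻¹ := CFC.sqrt_mul_sqrt_self _ hP.inv.posSemidef.nonneg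
  have hS_herm : S.IsHermitian := (CFC.sqrt_nonneg P⁻¹).isSelfAdjoint
  have hSNS : (S * N * S).IsHermitian := by
    simpa only [hS_herm.eq] using Matrix.isHermitian_conjTranspose_mul_mul S hN
  rw [← hSS, mul_assoc, Matrix.charpoly_mul_comm]
  exact hSNS.splits_charpoly

theorem exists_real_eigenpair {P N : Matrix ι ι ℝ} (hP : P.PosDef) (hN : N.IsHermitian) {z : ℂ}
    (hz : Module.End.HasEigenvalue
      (Matrix.toLin' ((P⁻¹ * N).map (fun x : ℝ => (x : ℂ)))) z) :
    ∃ l : ℝ, z = l ∧ ∃ x ≠ 0, N *ᵥ x = l • P *ᵥ x := by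
  have hmap : (P⁻¹ * N).map (fun x : ℝ => (x : ℂ)) = (P⁻¹ * N).map (algebraMap ℝ ℂ) := rfl
  rw [Module.End.hasEigenvalue_iff_isRoot_charpoly, Matrix.charpoly_toLin', hmap,
    Matrix.charpoly_map] at hz
  obtain ⟨l, rfl⟩ := (splits_charpoly_inv_mul hP hN).mem_range_of_isRoot
    (Matrix.charpoly_monic _).ne_zero hz
  have hroot : (P⁻¹ * N).charpoly.IsRoot l :=
    hz.of_map (algebraMap ℝ ℂ).injective
  rw [← Matrix.charpoly_toLin', ← Module.End.hasEigenvalue_iff_isRoot_charpoly] at hroot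
  obtain ⟨x, hx⟩ := hroot.exists_hasEigenvector
  refine ⟨l, rfl, x, hx.2, ?_⟩
  rw [← Matrix.mulVec_smul, ← hx.apply_eq_smul, Matrix.toLin'_apply, Matrix.mulVec_mulVec,
    Matrix.mul_nonsing_inv_cancel_left _ _ ((Matrix.isUnit_iff_isUnit_det P).1 hP.isUnit)]

theorem isSectorial_toBilin'_of_posSemidef {A : Matrix ι ι ℝ} (hA : A.PosSemidef) {μ : ℝ}
    (hμ : 0 ≤ μ) : IsSectorial (Matrix.toBilin' A) μ :=
  .of_isSymm (Matrix.isSymm_toBilin'_iff_isSymm.2 hA.isHermitian)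
    (fun x => by
      simpa only [Matrix.toBilin'_apply', star_trivial] using hA.dotProduct_mulVec_nonneg x) hμ

variable {A P Y : Matrix ι ι ℝ} {c C μ : ℝ}

theorem abs_mem_Ioo_of_flipped_pencil (hYY : Y * Y = 1) (hYt : Yᵀ = Y) (hP : P.PosDef)
    (hYP : Y * P = P * Y) (hYA : Y * A = Aᵀ * Y) (hlow : (symmPart A - c • P).PosDef)
    (hupp : (C • P - symmPart A).PosDef) (hA : IsSectorial (Matrix.toBilin' A) μ)
    {l : ℝ} {x : ι → ℝ} (hx : x ≠ 0) (hl : (Y * A) *ᵥ x = l • P *ᵥ x) :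
    |l| ∈ Set.Ioo c (C * √(1 + μ ^ 2)) := by
  set u := Y *ᵥ x with hu
  have hAx : A *ᵥ x = l • P *ᵥ u := by
    rw [hu, Matrix.mulVec_mulVec, ← hYP, ← Matrix.mulVec_mulVec, ← Matrix.mulVec_smul, ← hl,
      Matrix.mulVec_mulVec, ← mul_assoc, hYY, one_mul]
  have huPu : u ⬝ᵥ P *ᵥ u = x ⬝ᵥ P *ᵥ x := dotProduct_mulVec_mulVec_of_mul_eq_mul hYY hYt hYP x
  have huAu : u ⬝ᵥ A *ᵥ u = x ⬝ᵥ A *ᵥ x := by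
    rw [← dotProduct_mulVec_mulVec_of_mul_eq_mul hYY hYt hYA x, Matrix.dotProduct_transpose_mulVec]
  have hxPx : 0 < x ⬝ᵥ P *ᵥ x := hP.dotProduct_mulVec_pos hx
  have hlow' : c * (x ⬝ᵥ P *ᵥ x) < x ⬝ᵥ A *ᵥ x := by
    simpa only [Matrix.smul_mulVec, dotProduct_smul, smul_eq_mul, dotProduct_symmPart_mulVec]
      using dotProduct_mulVec_lt_of_posDef_sub hlow hx
  have hupp' : x ⬝ᵥ A *ᵥ x < C * (x ⬝ᵥ P *ᵥ x) := by
    simpa only [Matrix.smul_mulVec, dotProduct_smul, smul_eq_mul, dotProduct_symmPart_mulVec]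
      using dotProduct_mulVec_lt_of_posDef_sub hupp hx
  constructor
  · have hCS : |x ⬝ᵥ P *ᵥ u| ≤ x ⬝ᵥ P *ᵥ x := by
      simpa [Matrix.toBilin'_apply', huPu] using
        (isSectorial_toBilin'_of_posSemidef hP.posSemidef le_rfl).abs_apply_le
          (x := u) (y := x) (by simp only [Matrix.toBilin'_apply', huPu])
    refine lt_of_mul_lt_mul_right ?_ hxPx.le
    calc c * (x ⬝ᵥ P *ᵥ x) < x ⬝ᵥ A *ᵥ x := hlow'
      _ = l * (x ⬝ᵥ P *ᵥ u) := by rw [hAx, dotProduct_smul, smul_eq_mul]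
      _ ≤ |l| * |x ⬝ᵥ P *ᵥ u| := (le_abs_self _).trans_eq (abs_mul _ _)
      _ ≤ |l| * (x ⬝ᵥ P *ᵥ x) := by gcongr
  · have hsec : |u ⬝ᵥ A *ᵥ x| ≤ √(1 + μ ^ 2) * (x ⬝ᵥ A *ᵥ x) := by
      simpa only [Matrix.toBilin'_apply'] using
        hA.abs_apply_le (x := x) (y := u) (by simp only [Matrix.toBilin'_apply', huAu])
    refine lt_of_mul_lt_mul_right ?_ hxPx.le
    calc |l| * (x ⬝ᵥ P *ᵥ x) = |u ⬝ᵥ A *ᵥ x| := by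
          rw [hAx, dotProduct_smul, smul_eq_mul, abs_mul, huPu, abs_of_pos hxPx]
      _ ≤ √(1 + μ ^ 2) * (x ⬝ᵥ A *ᵥ x) := hsec
      _ < √(1 + μ ^ 2) * (C * (x ⬝ᵥ P *ᵥ x)) := by gcongr
      _ = C * √(1 + μ ^ 2) * (x ⬝ᵥ P *ᵥ x) := by ring

theorem exists_real_abs_mem_Ioo_of_hasEigenvalue (hYY : Y * Y = 1) (hYt : Yᵀ = Y) (hP : P.PosDef)
    (hYP : Y * P = P * Y) (hYA : Y * A = Aᵀ * Y) (hlow : (symmPart A - c • P).PosDef)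
    (hupp : (C • P - symmPart A).PosDef) (hA : IsSectorial (Matrix.toBilin' A) μ) {z : ℂ}
    (hz : Module.End.HasEigenvalue
      (Matrix.toLin' ((P⁻¹ * Y * A).map (fun x : ℝ => (x : ℂ)))) z) :
    ∃ l : ℝ, z = l ∧ |l| ∈ Set.Ioo c (C * √(1 + μ ^ 2)) := by
  have hYA_herm : (Y * A).IsHermitian := by
    rw [Matrix.IsHermitian, Matrix.conjTranspose_eq_transpose_of_trivial, Matrix.transpose_mul,
      hYt, hYA]
  rw [mul_assoc] at hz
  obtain ⟨l, rfl, x, hx, hl⟩ := exists_real_eigenpair hP hYA_herm hz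
  exact ⟨l, rfl, abs_mem_Ioo_of_flipped_pencil hYY hYt hP hYP hYA hlow hupp hA hx hl⟩

end Pencil

section DiagonalDominance

variable {ι : Type*} [Fintype ι]

theorem posSemidef_of_sum_abs_le_diag [DecidableEq ι] {A : Matrix ι ι ℝ} (hA : A.IsHermitian)
    (h : ∀ i, ∑ j ∈ Finset.univ.erase i, |A i j| ≤ A i i) : A.PosSemidef := by
  refine hA.posSemidef_iff_eigenvalues_nonneg.2 fun i => ?_
  have hev : Module.End.HasEigenvalue (Matrix.toLin' A) (hA.eigenvalues i) := by
    rw [Module.End.hasEigenvalue_iff_mem_spectrum, Matrix.spectrum_toLin']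
    exact hA.eigenvalues_mem_spectrum_real i
  obtain ⟨k, hk⟩ := eigenvalue_mem_ball hev
  rw [Metric.mem_closedBall, Real.dist_eq] at hk
  simp only [Real.norm_eq_abs] at hk
  change 0 ≤ hA.eigenvalues i
  linarith [(abs_le.1 hk).1, h k]

theorem posSemidef_of_abs_le_neg_of_diag_le {A C : Matrix ι ι ℝ} (hA : A.IsHermitian)
    (hC : ∀ i, 0 ≤ ∑ j, C i j) (hoff : ∀ i j, i ≠ j → |A i j| ≤ -C i j)
    (hdiag : ∀ i, C i i ≤ A i i) : A.PosSemidef := by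
  classical
  refine posSemidef_of_sum_abs_le_diag hA fun i => ?_
  have hsum : ∑ j ∈ Finset.univ.erase i, |A i j| ≤ ∑ j ∈ Finset.univ.erase i, -C i j :=
    Finset.sum_le_sum fun j hj => hoff i j (Finset.ne_of_mem_erase hj).symm
  rw [Finset.sum_neg_distrib] at hsum
  linarith [hC i, hdiag i, Finset.add_sum_erase Finset.univ (C i) (Finset.mem_univ i)]

end DiagonalDominance

section Tau

variable {m : ℕ} {T : Matrix (Fin m) (Fin m) ℝ}

/-- A symmetric Toeplitz matrix: the `(j, k)` entry depends only on `|j - k|`, and is hence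
determined by the first column. -/
def IsSymmToeplitz (T : Matrix (Fin m) (Fin m) ℝ) : Prop :=
  ∀ j k : Fin m, T j k = firstColumn T ((j : ℤ) - k).natAbs

theorem firstColumn_eq_zero {s : ℕ} (hs : m ≤ s) : firstColumn T s = 0 :=
  dif_neg hs.not_gt

theorem firstColumn_nonpos (hT : MonotoneOn (firstColumn T) (Set.Ici 1)) {s : ℕ} (hs : 1 ≤ s) :
    firstColumn T s ≤ 0 := by
  rw [← firstColumn_eq_zero (T := T) (le_add_right le_rfl : m ≤ m + s)]
  exact hT hs (hs.trans (Nat.le_add_left s m)) (Nat.le_add_left s m)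

theorem tauHankel_isSymm (T : Matrix (Fin m) (Fin m) ℝ) : (tauHankel T).IsSymm := by
  ext j k
  simp only [tauHankel, Matrix.transpose_apply, Matrix.of_apply, add_comm (k : ℕ)]

theorem sum_row_tauHankel (T : Matrix (Fin m) (Fin m) ℝ) (i : Fin m) :
    ∑ j, tauHankel T i j = 2 * ∑ s ∈ Finset.range m, firstColumn T s -
      ∑ s ∈ Finset.range (i + 2), firstColumn T s -
      ∑ s ∈ Finset.range (m - i + 1), firstColumn T s := by
  have hi := i.2
  set c := firstColumn T
  have htail {N : ℕ} (hN : m ≤ N) : ∑ s ∈ Finset.range N, c s = ∑ s ∈ Finset.range m, c s :=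
    Finset.eventually_constant_sum (fun s hs => firstColumn_eq_zero hs) hN
  have hsum (a : ℕ) : ∑ j ∈ Finset.range m, c (a + j) =
      ∑ s ∈ Finset.range m, c s - ∑ s ∈ Finset.range a, c s := by
    rw [← htail (Nat.le_add_left m a), Finset.sum_range_add, add_sub_cancel_left]
  calc ∑ j, tauHankel T i j
      = ∑ j ∈ Finset.range m, c (i + 2 + j) + ∑ j ∈ Finset.range m, c (2 * m - (i + j)) := by
        rw [← Finset.sum_add_distrib,
          ← Fin.sum_univ_eq_sum_range (fun j => c (i + 2 + j) + c (2 * m - (i + j)))]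
        simp only [tauHankel, Matrix.of_apply, c, add_right_comm]
    _ = ∑ j ∈ Finset.range m, c (i + 2 + j) + ∑ j ∈ Finset.range m, c (m - i + 1 + j) := by
        rw [← Finset.sum_range_reflect (fun j => c (2 * m - (i + j)))]
        refine congrArg _ (Finset.sum_congr rfl fun j hj => congrArg c ?_)
        have := Finset.mem_range.1 hj
        omega
    _ = _ := by
        rw [hsum, hsum]
        ring

theorem tauHankel_nonpos (hmono : MonotoneOn (firstColumn T) (Set.Ici 1)) (j k : Fin m) :
    tauHankel T j k ≤ 0 :=
  add_nonpos (firstColumn_nonpos hmono (by omega)) (firstColumn_nonpos hmono (by omega))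

namespace IsSymmToeplitz

theorem isSymm (hT : IsSymmToeplitz T) : T.IsSymm := by
  ext j k
  rw [Matrix.transpose_apply, hT, hT j k, ← Int.natAbs_neg, neg_sub]

theorem tau_rev (hT : IsSymmToeplitz T) (j k : Fin m) : tau T j.rev k.rev = tau T j k := by
  have hj := j.2
  have hk := k.2
  have hrev : ((j.rev : ℕ) : ℤ) - (k.rev : ℕ) = -((j : ℤ) - k) := by
    simp only [Fin.val_rev]; omega
  have hhankel : tauHankel T j.rev k.rev = tauHankel T j k := by
    simp only [tauHankel, Matrix.of_apply, Fin.val_rev]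
    rw [add_comm]
    congr 2 <;> omega
  rw [tau, Matrix.sub_apply, Matrix.sub_apply, hhankel, hT, hT j k, hrev, Int.natAbs_neg]

theorem sum_row (hT : IsSymmToeplitz T) (i : Fin m) :
    ∑ j, T i j = ∑ s ∈ Finset.range (i + 1), firstColumn T s +
      ∑ s ∈ Finset.range (m - i), firstColumn T s - firstColumn T 0 := by
  have hi := i.2
  set c := firstColumn T
  have hm : m = (i + 1) + (m - (i + 1)) := by omega
  have hm' : m - i = (m - (i + 1)) + 1 := by omega
  calc ∑ j, T i j = ∑ j ∈ Finset.range m, c ((i : ℤ) - j).natAbs := by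
        rw [← Fin.sum_univ_eq_sum_range (fun j => c ((i : ℤ) - j).natAbs)]
        exact Finset.sum_congr rfl fun j _ => hT i j
    _ = ∑ j ∈ Finset.range (i + 1), c (i - j) + ∑ s ∈ Finset.range (m - (i + 1)), c (s + 1) := by
        rw [congrArg Finset.range hm, Finset.sum_range_add]
        congr 1 <;> refine Finset.sum_congr rfl fun j hj => congrArg c ?_
        · have := Finset.mem_range.1 hj
          omega
        · omega
    _ = _ := by
        rw [hm', Finset.sum_range_succ' c (m - (i + 1)), ← Finset.sum_range_reflect c (i + 1)]
        simp only [Nat.add_sub_cancel]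
        ring

theorem sum_row_add_tauHankel (hT : IsSymmToeplitz T) (i : Fin m) :
    ∑ j, (T + tauHankel T) i j = 2 * ∑ s ∈ Finset.range m, firstColumn T s -
      firstColumn T 0 - firstColumn T (i + 1) - firstColumn T (m - i) := by
  simp only [Matrix.add_apply, Finset.sum_add_distrib, hT.sum_row, sum_row_tauHankel,
    Finset.sum_range_succ _ (i + 1 : ℕ), Finset.sum_range_succ _ (m - i : ℕ)]
  ring

theorem le_tauHankel (hT : IsSymmToeplitz T) (hmono : MonotoneOn (firstColumn T) (Set.Ici 1))
    {j k : Fin m} (hjk : j ≠ k) : T j k ≤ tauHankel T j k := by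
  have hj := j.2
  have hk := k.2
  have hne : (j : ℕ) ≠ k := Fin.val_ne_of_ne hjk
  have hle {s : ℕ} (hs : ((j : ℤ) - k).natAbs ≤ s) : T j k ≤ firstColumn T s := by
    rw [hT]
    exact hmono (Set.mem_Ici.2 (by omega)) (Set.mem_Ici.2 (by omega)) hs
  rw [tauHankel, Matrix.of_apply]
  rcases le_total ((j : ℕ) + k) m with h | h
  · rw [firstColumn_eq_zero (by omega : m ≤ 2 * m - (j + k)), add_zero]
    exact hle (by omega)
  · rw [firstColumn_eq_zero (by omega : m ≤ j + k + 2), zero_add]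
    exact hle (by omega)

variable (hT : IsSymmToeplitz T) (hmono : MonotoneOn (firstColumn T) (Set.Ici 1))
  (hsum : firstColumn T 0 ≤ 2 * ∑ s ∈ Finset.range m, firstColumn T s)
include hT hmono hsum

theorem sum_row_add_tauHankel_nonneg (i : Fin m) : 0 ≤ ∑ j, (T + tauHankel T) i j := by
  rw [hT.sum_row_add_tauHankel]
  linarith [firstColumn_nonpos hmono (by omega : 1 ≤ (i : ℕ) + 1),
    firstColumn_nonpos hmono (by omega : 1 ≤ m - i)]

theorem posSemidef_two_smul_sub_tau : ((2 : ℝ) • T - tau T).PosSemidef := by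
  have heq : (2 : ℝ) • T - tau T = T + tauHankel T := by rw [tau, two_smul]; abel
  rw [heq]
  refine posSemidef_of_abs_le_neg_of_diag_le (hT.isSymm.add (tauHankel_isSymm T))
    (hT.sum_row_add_tauHankel_nonneg hmono hsum) (fun j k hjk => ?_) fun _ => le_rfl
  refine (abs_of_nonpos (add_nonpos ?_ (tauHankel_nonpos hmono j k))).le
  exact (hT.le_tauHankel hmono hjk).trans (tauHankel_nonpos hmono j k)

theorem posSemidef_three_smul_tau_sub : ((3 : ℝ) • tau T - (2 : ℝ) • T).PosSemidef := by
  have heq : (3 : ℝ) • tau T - (2 : ℝ) • T = T - (3 : ℝ) • tauHankel T := by rw [tau]; module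
  rw [heq]
  refine posSemidef_of_abs_le_neg_of_diag_le (hT.isSymm.sub ((tauHankel_isSymm T).smul 3))
    (hT.sum_row_add_tauHankel_nonneg hmono hsum) (fun j k hjk => abs_le.2 ?_) fun j => ?_
  · have hTH := hT.le_tauHankel hmono hjk
    have hH := tauHankel_nonpos hmono j k
    simp only [Matrix.add_apply, Matrix.sub_apply, Matrix.smul_apply, smul_eq_mul]
    constructor <;> linarith
  · have hH := tauHankel_nonpos hmono j j
    simp only [Matrix.add_apply, Matrix.sub_apply, Matrix.smul_apply, smul_eq_mul]
    linarith

end IsSymmToeplitz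

end Tau

section Toeplitz

variable {m : ℕ} {c : ℤ → ℝ}

/-- The `m × m` Toeplitz matrix whose `n`-th diagonal, counted downwards from the main one, is
constantly `c n`. -/
def toeplitz (c : ℤ → ℝ) (m : ℕ) : Matrix (Fin m) (Fin m) ℝ :=
  Matrix.of fun j k => c ((j : ℤ) - k)

theorem symmPart_toeplitz (c : ℤ → ℝ) (m : ℕ) :
    symmPart (toeplitz c m) = toeplitz (fun n => (c n + c (-n)) / 2) m := by
  ext j k
  simp only [symmPart, toeplitz, Matrix.smul_apply, Matrix.add_apply, Matrix.transpose_apply,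
    Matrix.of_apply, smul_eq_mul, neg_sub]
  ring

theorem firstColumn_toeplitz (c : ℤ → ℝ) {s : ℕ} (hs : s < m) :
    firstColumn (toeplitz c m) s = c s := by
  simp [firstColumn, toeplitz, hs]

theorem isSymmToeplitz_toeplitz (hc : Function.Even c) : IsSymmToeplitz (toeplitz c m) := by
  intro j k
  rw [firstColumn_toeplitz c (by omega), toeplitz, Matrix.of_apply]
  rcases Int.natAbs_eq ((j : ℤ) - k) with h | h
  · rw [← h]
  · rw [← hc, neg_eq_iff_eq_neg.2 h]

theorem monotoneOn_firstColumn_toeplitz (hmono : MonotoneOn c (Set.Ici 1))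
    (hnonpos : ∀ n, 1 ≤ n → c n ≤ 0) : MonotoneOn (firstColumn (toeplitz c m)) (Set.Ici 1) := by
  intro r hr s hs hrs
  have hr' : (1 : ℤ) ≤ r := by exact_mod_cast hr
  have hs' : (1 : ℤ) ≤ s := by exact_mod_cast hs
  rcases lt_or_ge s m with hsm | hsm
  · rw [firstColumn_toeplitz c hsm, firstColumn_toeplitz c (hrs.trans_lt hsm)]
    exact hmono hr' hs' (by exact_mod_cast hrs)
  · rw [firstColumn_eq_zero hsm]
    rcases lt_or_ge r m with hrm | hrm
    · exact (firstColumn_toeplitz c hrm).trans_le (hnonpos r hr')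
    · exact (firstColumn_eq_zero hrm).le

end Toeplitz

section Grunwald

variable {α : ℝ}

theorem grunwaldCoeff_zero (α : ℝ) : grunwaldCoeff α 0 = 1 := by
  simp [grunwaldCoeff]

theorem grunwaldCoeff_succ (α : ℝ) (k : ℕ) :
    ((k : ℝ) + 1) * grunwaldCoeff α (k + 1) = ((k : ℝ) - α) * grunwaldCoeff α k := by
  simp only [grunwaldCoeff, Finset.prod_range_succ, Nat.factorial_succ, pow_succ]
  push_cast
  field_simp
  ring

theorem grunwaldCoeff_one (α : ℝ) : grunwaldCoeff α 1 = -α := by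
  simpa [grunwaldCoeff_zero] using grunwaldCoeff_succ α 0

theorem grunwaldCoeff_nonneg (hα : α ∈ Set.Icc 1 2) {k : ℕ} (hk : 2 ≤ k) :
    0 ≤ grunwaldCoeff α k := by
  obtain ⟨h1, h2⟩ := hα
  induction k, hk using Nat.le_induction with
  | base =>
    have h := grunwaldCoeff_succ α 1
    rw [grunwaldCoeff_one] at h
    norm_num at h
    nlinarith
  | succ k hk ih =>
    have hk' : (2 : ℝ) ≤ k := by exact_mod_cast hk
    have hpos : (0 : ℝ) < k + 1 := by positivity
    rw [← mul_nonneg_iff_of_pos_left hpos, grunwaldCoeff_succ]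
    exact mul_nonneg (by linarith) ih

theorem grunwaldCoeff_succ_le (hα : α ∈ Set.Icc 1 2) {k : ℕ} (hk : 2 ≤ k) :
    grunwaldCoeff α (k + 1) ≤ grunwaldCoeff α k := by
  have hpos : (0 : ℝ) < k + 1 := by positivity
  refine le_of_mul_le_mul_left ?_ hpos
  rw [grunwaldCoeff_succ]
  exact mul_le_mul_of_nonneg_right (by linarith [hα.1]) (grunwaldCoeff_nonneg hα hk)

theorem mul_sum_grunwaldCoeff (α : ℝ) (N : ℕ) :
    α * ∑ k ∈ Finset.range (N + 1), grunwaldCoeff α k =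
      -(((N : ℝ) + 1) * grunwaldCoeff α (N + 1)) := by
  induction N with
  | zero => simp [grunwaldCoeff_zero, grunwaldCoeff_one]
  | succ N ih =>
    rw [Finset.sum_range_succ, mul_add, ih, grunwaldCoeff_succ α (N + 1)]
    push_cast
    ring

theorem sum_grunwaldCoeff_nonpos (hα : α ∈ Set.Icc 1 2) {N : ℕ} (hN : 1 ≤ N) :
    ∑ k ∈ Finset.range (N + 1), grunwaldCoeff α k ≤ 0 := by
  have hg := grunwaldCoeff_nonneg hα (Nat.succ_le_succ hN)
  have hα0 : 0 < α := zero_lt_one.trans_le hα.1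
  refine nonpos_of_mul_nonpos_right ?_ hα0
  rw [mul_sum_grunwaldCoeff, neg_nonpos]
  positivity

theorem summable_abs_grunwaldCoeff (hα : α ∈ Set.Icc 1 2) :
    Summable fun k => |grunwaldCoeff α k| := by
  rw [← summable_nat_add_iff 2]
  refine summable_of_sum_range_le (c := α - 1) (fun _ => abs_nonneg _) fun N => ?_
  have habs : ∑ k ∈ Finset.range N, |grunwaldCoeff α (k + 2)| =
      ∑ k ∈ Finset.range N, grunwaldCoeff α (k + 2) :=
    Finset.sum_congr rfl fun k _ => abs_of_nonneg (grunwaldCoeff_nonneg hα (Nat.le_add_left 2 k))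
  have hsum := sum_grunwaldCoeff_nonpos hα (Nat.le_add_left 1 N)
  rw [Finset.sum_range_succ', Finset.sum_range_succ', grunwaldCoeff_zero, zero_add,
    grunwaldCoeff_one] at hsum
  linarith

/-- The sequence of diagonals of the shifted Grünwald matrices: `-g_{n+1}` for `n ≥ -1`. -/
def shiftedCoeff (α : ℝ) (n : ℤ) : ℝ :=
  if -1 ≤ n then -grunwaldCoeff α (n + 1).toNat else 0

theorem shiftedCoeff_natCast (α : ℝ) (k : ℕ) : shiftedCoeff α k = -grunwaldCoeff α (k + 1) :=
  if_pos (by omega)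

theorem shiftedCoeff_neg_one (α : ℝ) : shiftedCoeff α (-1) = -1 := by
  simp [shiftedCoeff, grunwaldCoeff_zero]

theorem shiftedCoeff_eq_zero (α : ℝ) {n : ℤ} (hn : n < -1) : shiftedCoeff α n = 0 :=
  if_neg hn.not_ge

theorem grunwaldMatrix_eq_toeplitz (α : ℝ) (m : ℕ) :
    grunwaldMatrix α m = toeplitz (shiftedCoeff α) m := by
  ext j k
  simp only [grunwaldMatrix, toeplitz, shiftedCoeff, Matrix.of_apply]
  congr 1
  · simp only [eq_iff_iff]; omega
  · congr 2; omega

/-- The sequence of diagonals of the symmetric parts of the shifted Grünwald matrices. -/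
def symmCoeff (α : ℝ) (n : ℤ) : ℝ :=
  (shiftedCoeff α n + shiftedCoeff α (-n)) / 2

theorem symmPart_grunwaldMatrix (α : ℝ) (m : ℕ) :
    symmPart (grunwaldMatrix α m) = toeplitz (symmCoeff α) m := by
  rw [grunwaldMatrix_eq_toeplitz, symmPart_toeplitz]
  rfl

theorem symmCoeff_even (α : ℝ) : Function.Even (symmCoeff α) := fun n => by
  rw [symmCoeff, symmCoeff, neg_neg, add_comm]

theorem symmCoeff_zero (α : ℝ) : symmCoeff α 0 = α := by
  have h := shiftedCoeff_natCast α 0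
  rw [zero_add, grunwaldCoeff_one, neg_neg] at h
  simp [symmCoeff, show shiftedCoeff α 0 = α from h]

theorem symmCoeff_one (α : ℝ) : symmCoeff α 1 = -(grunwaldCoeff α 2 + 1) / 2 := by
  have h := shiftedCoeff_natCast α 1
  rw [Nat.cast_one] at h
  rw [symmCoeff, h, shiftedCoeff_neg_one]
  ring

theorem symmCoeff_natCast (α : ℝ) {k : ℕ} (hk : 2 ≤ k) :
    symmCoeff α k = -grunwaldCoeff α (k + 1) / 2 := by
  rw [symmCoeff, shiftedCoeff_natCast, shiftedCoeff_eq_zero α (by omega), add_zero]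

theorem monotoneOn_symmCoeff (hα : α ∈ Set.Icc 1 2) :
    MonotoneOn (symmCoeff α) (Set.Ici 1) := by
  refine monotoneOn_of_le_add_one Set.ordConnected_Ici fun n _ hn _ => ?_
  lift n to ℕ using zero_le_one.trans hn
  have hn' : 1 ≤ n := by exact_mod_cast Set.mem_Ici.1 hn
  have hle := grunwaldCoeff_succ_le hα (Nat.succ_le_succ hn')
  rcases hn'.eq_or_lt with rfl | hn2
  · have h2 := symmCoeff_natCast α le_rfl
    push_cast at h2 hle ⊢
    rw [symmCoeff_one, h2]
    linarith
  · rw [symmCoeff_natCast α hn2, ← Nat.cast_succ, symmCoeff_natCast α (Nat.le_succ_of_le hn2)]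
    exact div_le_div_of_nonneg_right (neg_le_neg hle) two_pos.le

theorem symmCoeff_nonpos (hα : α ∈ Set.Icc 1 2) {n : ℤ} (hn : 1 ≤ n) : symmCoeff α n ≤ 0 := by
  lift n to ℕ using zero_le_one.trans hn
  have hn' : 1 ≤ n := by exact_mod_cast hn
  have hg := grunwaldCoeff_nonneg hα (Nat.succ_le_succ hn')
  rcases hn'.eq_or_lt with rfl | hn2
  · rw [Nat.cast_one, symmCoeff_one]
    linarith
  · rw [symmCoeff_natCast α hn2]
    linarith

theorem two_mul_sum_symmCoeff (α : ℝ) (m : ℕ) :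
    2 * ∑ s ∈ Finset.range (m + 2), symmCoeff α s =
      α - ∑ k ∈ Finset.range (m + 3), grunwaldCoeff α k := by
  induction m with
  | zero =>
    simp only [zero_add, Finset.sum_range_succ, Finset.sum_range_zero, Nat.cast_zero, Nat.cast_one,
      symmCoeff_zero, symmCoeff_one, grunwaldCoeff_zero, grunwaldCoeff_one]
    ring
  | succ m ih =>
    rw [Finset.sum_range_succ, mul_add, ih, Finset.sum_range_succ _ (m + 3),
      symmCoeff_natCast α (Nat.le_add_left 2 m)]
    ring

theorem le_two_mul_sum_symmCoeff (hα : α ∈ Set.Icc 1 2) {m : ℕ} (hm : 1 ≤ m) :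
    α ≤ 2 * ∑ s ∈ Finset.range m, symmCoeff α s := by
  obtain rfl | ⟨m, rfl⟩ : m = 1 ∨ ∃ r, m = r + 2 := by
    rcases hm.eq_or_lt with h | h
    exacts [.inl h.symm, .inr ⟨m - 2, by omega⟩]
  · rw [Finset.sum_range_one, Nat.cast_zero, symmCoeff_zero]
    linarith [hα.1]
  · rw [two_mul_sum_symmCoeff]
    linarith [sum_grunwaldCoeff_nonpos hα (Nat.le_add_left 1 (m + 1))]

theorem isSymmToeplitz_symmPart_grunwaldMatrix (α : ℝ) (m : ℕ) :
    IsSymmToeplitz (symmPart (grunwaldMatrix α m)) := by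
  rw [symmPart_grunwaldMatrix]
  exact isSymmToeplitz_toeplitz (symmCoeff_even α)

section TauBounds

variable (hα : α ∈ Set.Icc 1 2) (m : ℕ)
include hα

theorem monotoneOn_firstColumn_symmPart_grunwaldMatrix :
    MonotoneOn (firstColumn (symmPart (grunwaldMatrix α m))) (Set.Ici 1) := by
  rw [symmPart_grunwaldMatrix]
  exact monotoneOn_firstColumn_toeplitz (monotoneOn_symmCoeff hα) fun n => symmCoeff_nonpos hα

theorem firstColumn_symmPart_grunwaldMatrix_zero_le :
    firstColumn (symmPart (grunwaldMatrix α m)) 0 ≤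
      2 * ∑ s ∈ Finset.range m, firstColumn (symmPart (grunwaldMatrix α m)) s := by
  rw [symmPart_grunwaldMatrix]
  rcases m.eq_zero_or_pos with rfl | hm
  · simp [firstColumn]
  · rw [firstColumn_toeplitz _ hm, Nat.cast_zero, symmCoeff_zero, Finset.sum_congr rfl fun s hs =>
      firstColumn_toeplitz (symmCoeff α) (Finset.mem_range.1 hs)]
    exact le_two_mul_sum_symmCoeff hα hm

theorem posSemidef_two_smul_symmPart_grunwaldMatrix_sub_tau :
    ((2 : ℝ) • symmPart (grunwaldMatrix α m) - tau (symmPart (grunwaldMatrix α m))).PosSemidef :=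
  (isSymmToeplitz_symmPart_grunwaldMatrix α m).posSemidef_two_smul_sub_tau
    (monotoneOn_firstColumn_symmPart_grunwaldMatrix hα m)
    (firstColumn_symmPart_grunwaldMatrix_zero_le hα m)

theorem posSemidef_three_smul_tau_symmPart_grunwaldMatrix_sub :
    ((3 : ℝ) • tau (symmPart (grunwaldMatrix α m)) -
      (2 : ℝ) • symmPart (grunwaldMatrix α m)).PosSemidef :=
  (isSymmToeplitz_symmPart_grunwaldMatrix α m).posSemidef_three_smul_tau_sub
    (monotoneOn_firstColumn_symmPart_grunwaldMatrix hα m)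
    (firstColumn_symmPart_grunwaldMatrix_zero_le hα m)

end TauBounds

end Grunwald

section Fourier

open ComplexConjugate

variable {T : ℝ} [Fact (0 < T)] {m : ℕ}

theorem fourierCoeff_of_hasSum {a : ℤ → ℂ} (ha : Summable fun n => ‖a n‖) {f : AddCircle T → ℂ}
    (hf : ∀ t, HasSum (fun n => a n * fourier n t) (f t)) (k : ℤ) : fourierCoeff f k = a k := by
  have hcont (n : ℤ) : Continuous fun t : AddCircle T => fourier (-k) t * (a n * fourier n t) := by
    fun_prop
  have hnorm (n : ℤ) (t : AddCircle T) : ‖fourier (-k) t * (a n * fourier n t)‖ = ‖a n‖ := by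
    simp only [fourier_apply, norm_mul, Circle.norm_coe, one_mul, mul_one]
  have hint := MeasureTheory.hasSum_integral_of_summable_integral_norm
    (μ := AddCircle.haarAddCircle)
    (fun n => ((hcont n).integrable_of_hasCompactSupport
      (HasCompactSupport.of_compactSpace _)))
    (by simpa only [hnorm, MeasureTheory.integral_const, MeasureTheory.probReal_univ, one_smul])
  have hsingle (n : ℤ) : ∫ t : AddCircle T, fourier (-k) t * (a n * fourier n t)
      ∂AddCircle.haarAddCircle = if n = k then a k else 0 := by
    have h := fourierCoeff.const_mul (fourier n : AddCircle T → ℂ) (a n) k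
    rw [fourierCoeff_fourier] at h
    rcases eq_or_ne n k with rfl | hnk
    · simpa [fourierCoeff] using h
    · simpa [fourierCoeff, hnk, hnk.symm] using h
  simp only [hsingle, (((hf _).mul_left _).tsum_eq)] at hint
  exact hint.unique (hasSum_ite_eq k (a k))

theorem sum_fourierCoeff_eq_integral {f : AddCircle T → ℂ}
    (hf : MeasureTheory.Integrable f AddCircle.haarAddCircle) (w : Fin m → ℂ) :
    ∑ j : Fin m, ∑ k : Fin m, conj (w j) * w k * fourierCoeff f ((j : ℤ) - k) =
      ∫ t, f t * (‖∑ k : Fin m, w k * fourier (k : ℤ) t‖ ^ 2 : ℝ) ∂AddCircle.haarAddCircle := by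
  have hexpand (t : AddCircle T) : f t * (‖∑ k : Fin m, w k * fourier (k : ℤ) t‖ ^ 2 : ℝ) =
      ∑ j : Fin m, ∑ k : Fin m,
        conj (w j) * w k * (fourier (-((j : ℤ) - k)) t • f t) := by
    rw [Complex.ofReal_pow, ← Complex.conj_mul', map_sum, Finset.sum_mul_sum, Finset.mul_sum]
    refine Finset.sum_congr rfl fun j _ => ?_
    rw [Finset.mul_sum]
    refine Finset.sum_congr rfl fun k _ => ?_
    rw [neg_sub, sub_eq_neg_add, fourier_add, fourier_neg, map_mul, smul_eq_mul]
    ring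
  simp only [hexpand]
  rw [MeasureTheory.integral_finsetSum _ fun j _ => MeasureTheory.integrable_finsetSum _ fun k _ =>
    (hf.fourier_smul _).const_mul _]
  refine Finset.sum_congr rfl fun j _ => ?_
  rw [MeasureTheory.integral_finsetSum _ fun k _ => (hf.fourier_smul _).const_mul _]
  exact Finset.sum_congr rfl fun k _ => (MeasureTheory.integral_const_mul _ _).symm

end Fourier

section ToeplitzSector

open ComplexConjugate

variable {T : ℝ} [Fact (0 < T)] {m : ℕ} {c : ℤ → ℝ} {μ : ℝ}

theorem re_mul_sum_fourierCoeff_nonneg {f : AddCircle T → ℂ} (hf : Continuous f) {a : ℂ}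
    (ha : ∀ t, 0 ≤ (a * f t).re) (w : Fin m → ℂ) :
    0 ≤ (a * ∑ j : Fin m, ∑ k : Fin m, conj (w j) * w k * fourierCoeff f ((j : ℤ) - k)).re := by
  have hcont : Continuous fun t : AddCircle T =>
      a * (f t * (‖∑ k : Fin m, w k * fourier (k : ℤ) t‖ ^ 2 : ℝ)) := by fun_prop
  rw [sum_fourierCoeff_eq_integral (hf.integrable_of_hasCompactSupport (.of_compactSpace f)),
    ← MeasureTheory.integral_const_mul, ← Complex.reCLM_apply,
    ← Complex.reCLM.integral_comp_comm
      (hcont.integrable_of_hasCompactSupport (.of_compactSpace _))]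
  refine MeasureTheory.integral_nonneg fun t => ?_
  rw [Complex.reCLM_apply, ← mul_assoc, Complex.re_mul_ofReal]
  exact mul_nonneg (ha t) (sq_nonneg _)

theorem isSectorial_toBilin'_toeplitz {f : AddCircle T → ℂ} (hf : Continuous f)
    (hc : ∀ n, fourierCoeff f n = c n) (hre : ∀ t, 0 ≤ (f t).re)
    (him : ∀ t, |(f t).im| ≤ μ * (f t).re) : IsSectorial (Matrix.toBilin' (toeplitz c m)) μ := by
  set B := Matrix.toBilin' (toeplitz c m) with hB
  have hform (x y : Fin m → ℝ) : ∑ j : Fin m, ∑ k : Fin m,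
      conj ⟨x j, y j⟩ * ⟨x k, y k⟩ * fourierCoeff f ((j : ℤ) - k) =
      ⟨B x x + B y y, B x y - B y x⟩ := by
    simp only [hB, Matrix.toBilin'_apply, toeplitz, Matrix.of_apply, hc]
    apply Complex.ext <;>
    · simp only [Complex.re_sum, Complex.im_sum, ← Finset.sum_add_distrib,
        ← Finset.sum_sub_distrib]
      refine Finset.sum_congr rfl fun j _ => Finset.sum_congr rfl fun k _ => ?_
      simp only [Complex.mul_re, Complex.mul_im, Complex.conj_re, Complex.conj_im,
        Complex.ofReal_re, Complex.ofReal_im]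
      ring
  have hhalf {a : ℂ} (ha : ∀ t, 0 ≤ (a * f t).re) (x y : Fin m → ℝ) :
      0 ≤ a.re * (B x x + B y y) - a.im * (B x y - B y x) := by
    have h := re_mul_sum_fourierCoeff_nonneg hf ha fun j => ⟨x j, y j⟩
    rwa [hform, Complex.mul_re] at h
  constructor
  · intro x
    simpa using hhalf (a := 1) (by simpa using hre) x 0
  · intro x y
    have hlo := hhalf (a := ⟨μ, -1⟩) (fun t => by
      rw [Complex.mul_re]; linarith [(abs_le.1 (him t)).1]) x y
    have hhi := hhalf (a := ⟨μ, 1⟩) (fun t => by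
      rw [Complex.mul_re]; linarith [(abs_le.1 (him t)).2]) x y
    rw [abs_le]
    constructor <;> linarith

end ToeplitzSector

section GrunwaldSymbol

open ComplexConjugate

variable {α : ℝ}

theorem grunwaldCoeff_eq_choose (α : ℝ) (k : ℕ) :
    grunwaldCoeff α k = (-1) ^ k * Ring.choose α k := by
  have hpoch : ((descPochhammer ℤ k).smeval α : ℝ) = ∏ j ∈ Finset.range k, (α - (j : ℝ)) := by
    induction k with
    | zero => simp
    | succ k ih =>
      rw [descPochhammer_succ_right, Polynomial.smeval_mul, ih, Finset.prod_range_succ]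
      simp [Polynomial.smeval_natCast]
  rw [Ring.choose_eq_smul, hpoch, grunwaldCoeff, smul_eq_mul]
  ring

theorem hasSum_grunwaldCoeff_of_norm_lt_one (α : ℝ) {z : ℂ} (hz : ‖z‖ < 1) :
    HasSum (fun k : ℕ => (grunwaldCoeff α k : ℂ) * z ^ k) ((1 - z) ^ (α : ℂ)) := by
  have hball : -z ∈ Metric.eball (0 : ℂ) 1 := by
    rw [Metric.mem_eball, edist_zero_right, enorm_neg, ← ofReal_norm]
    exact ENNReal.ofReal_lt_one.2 hz
  have h := (Complex.one_add_cpow_hasFPowerSeriesOnBall_zero (a := (α : ℂ))).hasSum hball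
  rw [zero_add, ← sub_eq_add_neg] at h
  refine h.congr_fun fun k => ?_
  rw [binomialSeries_apply, grunwaldCoeff_eq_choose, ← Complex.ofReal_choose]
  simp only [List.ofFn_const, List.prod_replicate, smul_eq_mul, neg_pow z]
  push_cast
  ring

theorem re_one_sub_nonneg {z : ℂ} (hz : ‖z‖ ≤ 1) : 0 ≤ (1 - z).re := by
  rw [Complex.sub_re, Complex.one_re, sub_nonneg]
  exact (Complex.re_le_norm z).trans hz

theorem continuousOn_one_sub_cpow (hα : 0 < α) :
    ContinuousOn (fun z : ℂ => (1 - z) ^ (α : ℂ)) (Metric.closedBall 0 1) := fun z hz =>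
  have hcpow := Complex.continuousAt_cpow_const_of_re_pos (w := α)
    (.inl (re_one_sub_nonneg (mem_closedBall_zero_iff.1 hz))) (by simpa using hα)
  (hcpow.comp (f := fun z : ℂ => 1 - z) (by fun_prop)).continuousWithinAt

theorem hasSum_grunwaldCoeff (hα : α ∈ Set.Icc 1 2) {z : ℂ} (hz : ‖z‖ ≤ 1) :
    HasSum (fun k : ℕ => (grunwaldCoeff α k : ℂ) * z ^ k) ((1 - z) ^ (α : ℂ)) := by
  have hbound (k : ℕ) (z : ℂ) (hz : z ∈ Metric.closedBall (0 : ℂ) 1) :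
      ‖(grunwaldCoeff α k : ℂ) * z ^ k‖ ≤ |grunwaldCoeff α k| := by
    rw [norm_mul, norm_pow, Complex.norm_real, Real.norm_eq_abs]
    exact mul_le_of_le_one_right (abs_nonneg _)
      (pow_le_one₀ (norm_nonneg z) (mem_closedBall_zero_iff.1 hz))
  have hsummable := summable_abs_grunwaldCoeff hα
  have hEqOn : Set.EqOn (fun z : ℂ => ∑' k : ℕ, (grunwaldCoeff α k : ℂ) * z ^ k)
      (fun z => (1 - z) ^ (α : ℂ)) (Metric.closedBall 0 1) :=
    Set.EqOn.of_subset_closure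
      (fun z hz => (hasSum_grunwaldCoeff_of_norm_lt_one α (mem_ball_zero_iff.1 hz)).tsum_eq)
      (continuousOn_tsum (fun k => by fun_prop) hsummable hbound)
      (continuousOn_one_sub_cpow (zero_lt_one.trans_le hα.1))
      Metric.ball_subset_closedBall (closure_ball (0 : ℂ) one_ne_zero).ge
  have hz' : z ∈ Metric.closedBall (0 : ℂ) 1 := mem_closedBall_zero_iff.2 hz
  have hsum : Summable fun k : ℕ => (grunwaldCoeff α k : ℂ) * z ^ k :=
    .of_norm_bounded hsummable fun k => hbound k z hz'
  exact hsum.hasSum_iff.2 (hEqOn hz')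

/-- The symbol `-z⁻¹ (1 - z)^α` of the shifted Grünwald matrices, as a function on the unit
circle. -/
def grunwaldSymbol (α : ℝ) (z : ℂ) : ℂ :=
  -(z⁻¹ * (1 - z) ^ (α : ℂ))

theorem hasSum_shiftedCoeff (hα : α ∈ Set.Icc 1 2) {z : ℂ} (hz : ‖z‖ = 1) :
    HasSum (fun n : ℤ => (shiftedCoeff α n : ℂ) * z ^ n) (grunwaldSymbol α z) := by
  have hz0 : z ≠ 0 := norm_ne_zero_iff.1 (hz ▸ one_ne_zero)
  have hinj : Function.Injective fun k : ℕ => (k : ℤ) - 1 := fun j k h => by simpa using h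
  have hzero (n : ℤ) (hn : n ∉ Set.range fun k : ℕ => (k : ℤ) - 1) :
      (shiftedCoeff α n : ℂ) * z ^ n = 0 := by
    have hlt : n < -1 := by
      by_contra! hge
      exact hn ⟨(n + 1).toNat, by dsimp only; omega⟩
    rw [shiftedCoeff_eq_zero α hlt, Complex.ofReal_zero, zero_mul]
  rw [← hinj.hasSum_iff hzero]
  have h := ((hasSum_grunwaldCoeff hα hz.le).mul_left z⁻¹).neg
  refine h.congr_fun fun k => ?_
  have hk : shiftedCoeff α ((k : ℤ) - 1) = -grunwaldCoeff α k := by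
    rw [shiftedCoeff, if_pos (by omega), sub_add_cancel, Int.toNat_natCast]
  rw [Function.comp_apply, hk, zpow_sub_one₀ hz0, zpow_natCast]
  push_cast
  ring

theorem grunwaldSymbol_eq {z : ℂ} (hz : ‖z‖ = 1) (hz1 : z ≠ 1) :
    grunwaldSymbol α z = (‖1 - z‖ ^ α : ℝ) *
      Complex.exp (((α - 2) * Complex.arg (1 - z) : ℝ) * Complex.I) := by
  have hz0 : z ≠ 0 := norm_ne_zero_iff.1 (hz ▸ one_ne_zero)
  have hw : 1 - z ≠ 0 := sub_ne_zero.2 hz1.symm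
  have hphase : -z⁻¹ = Complex.exp (conj (Complex.log (1 - z)) - Complex.log (1 - z)) := by
    rw [Complex.exp_sub, Complex.exp_conj, Complex.exp_log hw, map_sub, map_one,
      ← Complex.inv_eq_conj hz]
    field_simp
    ring
  rw [grunwaldSymbol, ← neg_mul, hphase, Complex.cpow_def_of_ne_zero hw, ← Complex.exp_add,
    Real.rpow_def_of_pos (norm_pos_iff.2 hw), Complex.ofReal_exp, ← Complex.exp_add]
  congr 1
  apply Complex.ext
  · simp [Complex.log_re]
  · simp only [Complex.add_im, Complex.sub_im, Complex.conj_im, Complex.log_im, Complex.mul_im,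
      Complex.ofReal_im, Complex.ofReal_re, Complex.I_im, Complex.I_re]
    ring

theorem abs_sin_le_tan_mul_cos {φ ψ : ℝ} (h : |φ| ≤ ψ) (hψ : ψ < Real.pi / 2) :
    |Real.sin φ| ≤ Real.tan ψ * Real.cos φ := by
  have hφ : |φ| ∈ Set.Ioo (-(Real.pi / 2)) (Real.pi / 2) :=
    ⟨by linarith [abs_nonneg φ, Real.pi_pos], h.trans_lt hψ⟩
  have hcos : 0 < Real.cos |φ| := Real.cos_pos_of_mem_Ioo hφ
  rw [Real.abs_sin_eq_sin_abs_of_abs_le_pi (by linarith [hφ.2, Real.pi_pos]), ← Real.cos_abs φ,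
    ← div_le_iff₀ hcos, ← Real.tan_eq_sin_div_cos]
  exact Real.strictMonoOn_tan.monotoneOn hφ ⟨hφ.1.trans_le h, hψ⟩ h

theorem grunwaldSymbol_mem_sector (hα : α ∈ Set.Ioc 1 2) {z : ℂ} (hz : ‖z‖ = 1) :
    0 ≤ (grunwaldSymbol α z).re ∧
      |(grunwaldSymbol α z).im| ≤ |Real.tan (α / 2 * Real.pi)| * (grunwaldSymbol α z).re := by
  have hpi := Real.pi_pos
  rcases eq_or_ne z 1 with rfl | hz1
  · have hα0 : (α : ℂ) ≠ 0 := by exact_mod_cast (zero_lt_one.trans hα.1).ne'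
    simp [grunwaldSymbol, Complex.zero_cpow hα0]
  set φ := (α - 2) * Complex.arg (1 - z) with hφ
  set ψ := Real.pi - α / 2 * Real.pi with hψ
  have hψ_lt : ψ < Real.pi / 2 := by nlinarith [hα.1]
  have hφψ : |φ| ≤ ψ := by
    have harg := Complex.abs_arg_le_pi_div_two_iff.2 (re_one_sub_nonneg hz.le)
    calc |φ| = (2 - α) * |Complex.arg (1 - z)| := by
          rw [hφ, abs_mul, abs_of_nonpos (sub_nonpos.2 hα.2), neg_sub]
      _ ≤ (2 - α) * (Real.pi / 2) := mul_le_mul_of_nonneg_left harg (sub_nonneg.2 hα.2)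
      _ = ψ := by ring
  have htan : |Real.tan (α / 2 * Real.pi)| = Real.tan ψ := by
    rw [← abs_neg, ← Real.tan_pi_sub, abs_of_nonneg
      (Real.tan_nonneg_of_nonneg_of_le_pi_div_two ((abs_nonneg φ).trans hφψ) hψ_lt.le)]
  have hr : 0 ≤ ‖1 - z‖ ^ α := Real.rpow_nonneg (norm_nonneg _) α
  rw [grunwaldSymbol_eq hz hz1, Complex.re_ofReal_mul, Complex.im_ofReal_mul,
    Complex.exp_ofReal_mul_I_re, Complex.exp_ofReal_mul_I_im, abs_mul, abs_of_nonneg hr, htan,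
    mul_left_comm]
  obtain ⟨hlo, hhi⟩ := abs_le.1 hφψ
  exact ⟨mul_nonneg hr (Real.cos_nonneg_of_neg_pi_div_two_le_of_le (by linarith) (by linarith)),
    mul_le_mul_of_nonneg_left (abs_sin_le_tan_mul_cos hφψ hψ_lt) hr⟩

theorem continuous_grunwaldSymbol_toCircle (hα : 0 < α) :
    Continuous fun t : UnitAddCircle => grunwaldSymbol α t.toCircle := by
  have hcoe : Continuous fun t : UnitAddCircle => (t.toCircle : ℂ) :=
    continuous_subtype_val.comp AddCircle.continuous_toCircle
  have hcpow : Continuous fun t : UnitAddCircle => (1 - (t.toCircle : ℂ)) ^ (α : ℂ) :=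
    (continuousOn_one_sub_cpow hα).comp_continuous hcoe
      fun t => mem_closedBall_zero_iff.2 (Circle.norm_coe _).le
  exact ((hcoe.inv₀ fun t => Circle.coe_ne_zero _).mul hcpow).neg

theorem fourierCoeff_grunwaldSymbol (hα : α ∈ Set.Icc 1 2) (n : ℤ) :
    fourierCoeff (fun t : UnitAddCircle => grunwaldSymbol α t.toCircle) n = shiftedCoeff α n := by
  refine fourierCoeff_of_hasSum (a := fun n => (shiftedCoeff α n : ℂ)) ?_ (fun t => ?_) n
  · simpa using (hasSum_shiftedCoeff hα norm_one).summable.norm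
  · simpa only [fourier_apply, AddCircle.toCircle_zsmul, Circle.coe_zpow]
      using hasSum_shiftedCoeff hα (Circle.norm_coe t.toCircle)

theorem isSectorial_toBilin'_grunwaldMatrix (hα : α ∈ Set.Ioc 1 2) (m : ℕ) :
    IsSectorial (Matrix.toBilin' (grunwaldMatrix α m)) |Real.tan (α / 2 * Real.pi)| := by
  have hsector (t : UnitAddCircle) := grunwaldSymbol_mem_sector hα (Circle.norm_coe t.toCircle)
  rw [grunwaldMatrix_eq_toeplitz]
  exact isSectorial_toBilin'_toeplitz
    (continuous_grunwaldSymbol_toCircle (zero_lt_one.trans hα.1))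
    (fourierCoeff_grunwaldSymbol (Set.Ioc_subset_Icc_self hα))
    (fun t => (hsector t).1) (fun t => (hsector t).2)

end GrunwaldSymbol

section AntiIdentity

variable {m : ℕ}

theorem antiIdentity_eq_submatrix (m : ℕ) :
    antiIdentity m = (1 : Matrix (Fin m) (Fin m) ℝ).submatrix Fin.rev id := by
  ext j k
  simp only [antiIdentity, Matrix.of_apply, Matrix.submatrix_apply, id_eq, Matrix.one_apply,
    Fin.ext_iff, Fin.val_rev]
  congr 1
  rw [eq_iff_iff]
  omega

theorem antiIdentity_mul_eq_mul_antiIdentity {B C : Matrix (Fin m) (Fin m) ℝ}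
    (h : ∀ j k, B j.rev k.rev = C j k) : antiIdentity m * B = C * antiIdentity m := by
  ext j k
  have hC (l : Fin m) : l.rev = k ↔ l = k.rev := Fin.rev_eq_iff
  simp [antiIdentity_eq_submatrix, Matrix.mul_apply, Matrix.one_apply, hC, ← h]

theorem antiIdentity_mul_self (m : ℕ) : antiIdentity m * antiIdentity m = 1 := by
  ext j k
  simp [antiIdentity_eq_submatrix, Matrix.mul_apply, Matrix.one_apply, eq_comm (a := j.rev),
    Fin.rev_eq_iff, eq_comm (a := k)]

theorem antiIdentity_transpose (m : ℕ) : (antiIdentity m)ᵀ = antiIdentity m := by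
  ext j k
  simp only [antiIdentity, Matrix.transpose_apply, Matrix.of_apply, add_comm (k : ℕ)]

end AntiIdentity

section Kronecker

open scoped Kronecker

variable {d : ℕ} {n : Fin d → ℕ}

theorem kron_mul_kron (B C : ∀ i, Matrix (Fin (n i)) (Fin (n i)) ℝ) :
    kron B * kron C = kron fun i => B i * C i := by
  ext p q
  simp only [kron, Matrix.mul_apply, Matrix.of_apply, ← Finset.prod_mul_distrib]
  exact (Fintype.prod_sum fun i r => B i (p i) r * C i r (q i)).symm

theorem kron_one : kron (fun i => (1 : Matrix (Fin (n i)) (Fin (n i)) ℝ)) = 1 := by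
  ext p q
  simp only [kron, Matrix.of_apply, Matrix.one_apply, Finset.prod_boole, Finset.mem_univ,
    forall_const, funext_iff]

theorem kron_transpose (B : ∀ i, Matrix (Fin (n i)) (Fin (n i)) ℝ) :
    (kron B)ᵀ = kron fun i => (B i)ᵀ := rfl

theorem kronAt_eq_submatrix (i : Fin d) (B : Matrix (Fin (n i)) (Fin (n i)) ℝ) :
    kronAt i B = (B ⊗ₖ (1 : Matrix (∀ j : {j // j ≠ i}, Fin (n j)) _ ℝ)).submatrix
      (Equiv.piSplitAt i fun j => Fin (n j)) (Equiv.piSplitAt i fun j => Fin (n j)) := by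
  ext p q
  have hne (j : {j // j ≠ i}) :
      (Function.update (fun _ => 1) i B : ∀ j, Matrix (Fin (n j)) (Fin (n j)) ℝ) j (p j) (q j) =
        if p j = q j then 1 else 0 := by
    rw [Function.update_of_ne j.2, Matrix.one_apply]
  simp only [kronAt, kron, Matrix.of_apply, Matrix.submatrix_apply, Matrix.kroneckerMap_apply,
    Fintype.prod_eq_mul_prod_subtype_ne _ i, Function.update_self, hne, Finset.prod_boole,
    Finset.mem_univ, forall_const, Matrix.one_apply, Equiv.piSplitAt_apply, funext_iff]

theorem isLinearMap_kronAt (i : Fin d) :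
    IsLinearMap ℝ (kronAt i : Matrix (Fin (n i)) (Fin (n i)) ℝ → _) where
  map_add B C := by
    simp only [kronAt_eq_submatrix, Matrix.add_kronecker, Matrix.submatrix_add, Pi.add_apply]
  map_smul a B := by
    simp only [kronAt_eq_submatrix, Matrix.smul_kronecker, Matrix.submatrix_smul, Pi.smul_apply]

theorem kronAt_transpose (i : Fin d) (B : Matrix (Fin (n i)) (Fin (n i)) ℝ) :
    (kronAt i B)ᵀ = kronAt i Bᵀ := by
  rw [kronAt_eq_submatrix, kronAt_eq_submatrix, Matrix.transpose_submatrix,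
    ← Matrix.kroneckerMap_transpose, Matrix.transpose_one]

theorem posSemidef_kronAt (i : Fin d) {B : Matrix (Fin (n i)) (Fin (n i)) ℝ} (hB : B.PosSemidef) :
    (kronAt i B).PosSemidef := by
  rw [kronAt_eq_submatrix]
  exact (hB.kronecker .one).submatrix _

theorem toBilin'_kronAt (i : Fin d) (B : Matrix (Fin (n i)) (Fin (n i)) ℝ) :
    Matrix.toBilin' (kronAt i B) = ∑ r : ∀ j : {j // j ≠ i}, Fin (n j),
      (Matrix.toBilin' B).compl₁₂
        (LinearMap.funLeft ℝ ℝ fun a => (Equiv.piSplitAt i fun j => Fin (n j)).symm (a, r))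
        (LinearMap.funLeft ℝ ℝ fun a => (Equiv.piSplitAt i fun j => Fin (n j)).symm (a, r)) := by
  refine LinearMap.ext₂ fun x y => ?_
  let e := (Equiv.piSplitAt i fun j => Fin (n j)).symm
  simp only [LinearMap.sum_apply, LinearMap.compl₁₂_apply, Matrix.toBilin'_apply,
    LinearMap.funLeft_apply, kronAt_eq_submatrix]
  rw [← e.sum_comp, Fintype.sum_prod_type_right]
  refine Finset.sum_congr rfl fun r _ => Finset.sum_congr rfl fun a _ => ?_
  rw [← e.sum_comp, Fintype.sum_prod_type]
  simp [e, Matrix.one_apply]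

theorem isSectorial_toBilin'_kronAt (i : Fin d) {B : Matrix (Fin (n i)) (Fin (n i)) ℝ} {μ : ℝ}
    (hB : IsSectorial (Matrix.toBilin' B) μ) : IsSectorial (Matrix.toBilin' (kronAt i B)) μ := by
  rw [toBilin'_kronAt]
  exact .sum _ fun r _ => hB.comp _

theorem multiAntiIdentity_mul_kronAt {i : Fin d} {B C : Matrix (Fin (n i)) (Fin (n i)) ℝ}
    (h : antiIdentity (n i) * B = C * antiIdentity (n i)) :
    multiAntiIdentity n * kronAt i B = kronAt i C * multiAntiIdentity n := by
  rw [multiAntiIdentity, kronAt, kronAt, kron_mul_kron, kron_mul_kron]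
  congr 1
  funext j
  rcases eq_or_ne j i with rfl | hj
  · rw [Function.update_self, Function.update_self, h]
  · rw [Function.update_of_ne hj, Function.update_of_ne hj, mul_one, one_mul]

theorem multiAntiIdentity_mul_self (n : Fin d → ℕ) :
    multiAntiIdentity n * multiAntiIdentity n = 1 := by
  simp only [multiAntiIdentity, kron_mul_kron, antiIdentity_mul_self, kron_one]

theorem multiAntiIdentity_transpose (n : Fin d → ℕ) :
    (multiAntiIdentity n)ᵀ = multiAntiIdentity n := by
  simp only [multiAntiIdentity, kron_transpose, antiIdentity_transpose]

end Kronecker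

section KronSum

variable {d : ℕ} {n : Fin d → ℕ} {ν μ : ℝ} {B C : ∀ i, Matrix (Fin (n i)) (Fin (n i)) ℝ}

/-- The Kronecker sum of the matrices `B i`, shifted by `ν`: the common shape of the coefficient
matrix and of its preconditioner. -/
def kronSum (ν : ℝ) (B : ∀ i, Matrix (Fin (n i)) (Fin (n i)) ℝ) :
    Matrix (∀ i, Fin (n i)) (∀ i, Fin (n i)) ℝ :=
  ν • 1 + ∑ i, kronAt i (B i)

theorem kronSum_add (ν κ : ℝ) (B C : ∀ i, Matrix (Fin (n i)) (Fin (n i)) ℝ) :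
    kronSum ν B + kronSum κ C = kronSum (ν + κ) (B + C) := by
  simp only [kronSum, Pi.add_apply, (isLinearMap_kronAt _).map_add, Finset.sum_add_distrib,
    add_smul]
  abel

theorem smul_kronSum (a ν : ℝ) (B : ∀ i, Matrix (Fin (n i)) (Fin (n i)) ℝ) :
    a • kronSum ν B = kronSum (a * ν) (a • B) := by
  simp only [kronSum, Pi.smul_apply, (isLinearMap_kronAt _).map_smul, Finset.smul_sum, smul_add,
    smul_smul]

theorem kronSum_sub (ν κ : ℝ) (B C : ∀ i, Matrix (Fin (n i)) (Fin (n i)) ℝ) :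
    kronSum ν B - kronSum κ C = kronSum (ν - κ) (B - C) := by
  rw [eq_comm, eq_sub_iff_add_eq, kronSum_add, sub_add_cancel, sub_add_cancel]

theorem kronSum_transpose (ν : ℝ) (B : ∀ i, Matrix (Fin (n i)) (Fin (n i)) ℝ) :
    (kronSum ν B)ᵀ = kronSum ν fun i => (B i)ᵀ := by
  simp only [kronSum, Matrix.transpose_add, Matrix.transpose_smul, Matrix.transpose_one,
    Matrix.transpose_sum, kronAt_transpose]

theorem symmPart_kronSum (ν : ℝ) (B : ∀ i, Matrix (Fin (n i)) (Fin (n i)) ℝ) :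
    symmPart (kronSum ν B) = kronSum ν fun i => symmPart (B i) := by
  rw [symmPart, kronSum_transpose, kronSum_add, smul_kronSum, ← two_mul, ← mul_assoc,
    one_div_mul_cancel two_ne_zero, one_mul]
  rfl

theorem posDef_kronSum (hν : 0 < ν) (hB : ∀ i, (B i).PosSemidef) : (kronSum ν B).PosDef :=
  (Matrix.PosDef.one.smul hν).add_posSemidef
    (Matrix.posSemidef_sum _ fun i _ => posSemidef_kronAt i (hB i))

theorem isSectorial_toBilin'_kronSum (hν : 0 ≤ ν) (hμ : 0 ≤ μ)
    (hB : ∀ i, IsSectorial (Matrix.toBilin' (B i)) μ) :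
    IsSectorial (Matrix.toBilin' (kronSum ν B)) μ := by
  rw [kronSum, map_add, map_sum]
  exact (isSectorial_toBilin'_of_posSemidef (Matrix.PosSemidef.one.smul hν) hμ).add
    (.sum _ fun i _ => isSectorial_toBilin'_kronAt i (hB i))

theorem multiAntiIdentity_mul_kronSum (ν : ℝ) (h : ∀ i j k, B i j.rev k.rev = C i j k) :
    multiAntiIdentity n * kronSum ν B = kronSum ν C * multiAntiIdentity n := by
  simp only [kronSum, mul_add, add_mul, mul_smul_comm, smul_mul_assoc, mul_one, one_mul,
    Finset.mul_sum, Finset.sum_mul,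
    multiAntiIdentity_mul_kronAt (antiIdentity_mul_eq_mul_antiIdentity (h _))]

end KronSum

section Problem

theorem symmPart_smul_add_smul_transpose {ι : Type*} (a b : ℝ) (A : Matrix ι ι ℝ) :
    symmPart (a • A + b • Aᵀ) = (a + b) • symmPart A := by
  simp only [symmPart, Matrix.transpose_add, Matrix.transpose_smul, Matrix.transpose_transpose]
  module

theorem toBilin'_smul_add_smul_transpose {ι : Type*} [Fintype ι] [DecidableEq ι] (a b : ℝ)
    (A : Matrix ι ι ℝ) : Matrix.toBilin' (a • A + b • Aᵀ) =
      a • Matrix.toBilin' A + b • (Matrix.toBilin' A).flip := by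
  refine LinearMap.ext₂ fun x y => ?_
  simp only [map_add, map_smul, LinearMap.add_apply, LinearMap.smul_apply,
    LinearMap.BilinForm.flip_apply, Matrix.toBilin'_apply', Matrix.dotProduct_transpose_mulVec]

theorem grunwaldMatrix_rev (α : ℝ) {m : ℕ} (j k : Fin m) :
    grunwaldMatrix α m j.rev k.rev = (grunwaldMatrix α m)ᵀ j k := by
  rw [grunwaldMatrix_eq_toeplitz, Matrix.transpose_apply, toeplitz, Matrix.of_apply,
    Matrix.of_apply, Fin.val_rev, Fin.val_rev]
  congr 1
  omega

theorem posSemidef_tau_symmPart_grunwaldMatrix {α : ℝ} (hα : α ∈ Set.Icc 1 2) (m : ℕ) :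
    (tau (symmPart (grunwaldMatrix α m))).PosSemidef := by
  have h := (posSemidef_two_smul_symmPart_grunwaldMatrix_sub_tau hα m).add
    (posSemidef_three_smul_tau_symmPart_grunwaldMatrix_sub hα m)
  have h2 := h.smul (one_half_pos (α := ℝ)).le
  convert h2 using 1
  module

theorem le_epsBound {d : ℕ} (α dPlus dMinus : Fin d → ℝ) (i : Fin d) :
    |dPlus i - dMinus i| / (dPlus i + dMinus i) * |Real.tan (α i / 2 * Real.pi)| ≤
      epsBound α dPlus dMinus :=
  le_ciSup (f := fun i => |dPlus i - dMinus i| / (dPlus i + dMinus i) *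
    |Real.tan (α i / 2 * Real.pi)|) (Set.finite_range _).bddAbove i

theorem epsBound_nonneg {d : ℕ} (α : Fin d → ℝ) {dPlus dMinus : Fin d → ℝ} {i : Fin d}
    (hi : 0 ≤ dPlus i + dMinus i) : 0 ≤ epsBound α dPlus dMinus :=
  (mul_nonneg (div_nonneg (abs_nonneg _) hi) (abs_nonneg _)).trans (le_epsBound α dPlus dMinus i)

theorem sqrt_one_add_sq_le {μ : ℝ} (hμ : 0 ≤ μ) : √(1 + μ ^ 2) ≤ 1 + μ :=
  Real.sqrt_le_iff.2 ⟨by linarith, by nlinarith⟩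

theorem sqrt_one_add_sq_lt {μ : ℝ} (hμ : 0 < μ) : √(1 + μ ^ 2) < 1 + μ :=
  (Real.sqrt_lt' (by linarith)).2 (by nlinarith)

theorem mem_Ioo_union_Ioo_of_abs_mem_Ioo {a b l : ℝ} (hl : |l| ∈ Set.Ioo a b) :
    l ∈ Set.Ioo (-b) (-a) ∪ Set.Ioo a b := by
  obtain ⟨hlo, hhi⟩ := abs_lt.1 hl.2
  rcases lt_abs.1 hl.1 with h | h
  · exact Or.inr ⟨h, hhi⟩
  · exact Or.inl ⟨hlo, lt_neg.1 h⟩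

namespace Problem

variable {d : ℕ} {p : Problem d} {n : Fin d → ℕ} {M : ℕ}

theorem coeffMatrix_eq_kronSum (p : Problem d) (n : Fin d → ℕ) (M : ℕ) :
    p.coeffMatrix n M = kronSum (p.nu M) fun i => p.vPlus n i • grunwaldMatrix (p.α i) (n i) +
      p.vMinus n i • (grunwaldMatrix (p.α i) (n i))ᵀ := by
  simp only [coeffMatrix, kronSum, kronAt_transpose, (isLinearMap_kronAt _).map_add,
    (isLinearMap_kronAt _).map_smul]

theorem tauPrecond_eq_kronSum (p : Problem d) (n : Fin d → ℕ) (M : ℕ) :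
    p.tauPrecond n M = kronSum (p.nu M) fun i => (p.vPlus n i + p.vMinus n i) •
      tau (symmPart (grunwaldMatrix (p.α i) (n i))) := by
  simp only [tauPrecond, kronSum, (isLinearMap_kronAt _).map_smul]

theorem symmPart_coeffMatrix (p : Problem d) (n : Fin d → ℕ) (M : ℕ) :
    symmPart (p.coeffMatrix n M) = kronSum (p.nu M) fun i =>
      (p.vPlus n i + p.vMinus n i) • symmPart (grunwaldMatrix (p.α i) (n i)) := by
  simp only [coeffMatrix_eq_kronSum, symmPart_kronSum, symmPart_smul_add_smul_transpose]

theorem nu_pos (hT : 0 < p.T) (hM : 1 ≤ M) : 0 < p.nu M :=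
  one_div_pos.2 (div_pos hT (Nat.cast_pos.2 hM))

theorem h_rpow_pos {i : Fin d} (hab : p.a i < p.b i) : 0 < p.h n i ^ p.α i :=
  Real.rpow_pos_of_pos (div_pos (sub_pos.2 hab) (Nat.cast_add_one_pos _)) _

theorem vPlus_add_vMinus_nonneg {i : Fin d} (hab : p.a i < p.b i)
    (hsum : 0 ≤ p.dPlus i + p.dMinus i) : 0 ≤ p.vPlus n i + p.vMinus n i := by
  rw [vPlus, vMinus, ← add_div]
  exact div_nonneg hsum (h_rpow_pos hab).le

theorem abs_vPlus_sub_vMinus_mul_le {i : Fin d} (hab : p.a i < p.b i)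
    (hsum : 0 < p.dPlus i + p.dMinus i) :
    |p.vPlus n i - p.vMinus n i| * |Real.tan (p.α i / 2 * Real.pi)| ≤
      epsBound p.α p.dPlus p.dMinus * (p.vPlus n i + p.vMinus n i) := by
  have h := le_epsBound p.α p.dPlus p.dMinus i
  rw [div_mul_eq_mul_div, div_le_iff₀ hsum] at h
  rw [vPlus, vMinus, ← sub_div, ← add_div, abs_div, abs_of_pos (h_rpow_pos hab),
    div_mul_eq_mul_div, mul_div_assoc']
  exact div_le_div_of_nonneg_right h (h_rpow_pos hab).le

theorem multiAntiIdentity_mul_coeffMatrix (p : Problem d) (n : Fin d → ℕ) (M : ℕ) :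
    multiAntiIdentity n * p.coeffMatrix n M = (p.coeffMatrix n M)ᵀ * multiAntiIdentity n := by
  rw [coeffMatrix_eq_kronSum, kronSum_transpose]
  refine multiAntiIdentity_mul_kronSum _ fun i j k => ?_
  simp only [Matrix.transpose_apply, Matrix.add_apply, Matrix.smul_apply, grunwaldMatrix_rev]

theorem multiAntiIdentity_mul_tauPrecond (p : Problem d) (n : Fin d → ℕ) (M : ℕ) :
    multiAntiIdentity n * p.tauPrecond n M = p.tauPrecond n M * multiAntiIdentity n := by
  rw [tauPrecond_eq_kronSum]
  refine multiAntiIdentity_mul_kronSum _ fun i j k => ?_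
  rw [Matrix.smul_apply, Matrix.smul_apply,
    (isSymmToeplitz_symmPart_grunwaldMatrix (p.α i) (n i)).tau_rev]

theorem isSectorial_toBilin'_coeffMatrix {μ : ℝ} (hμ : 0 ≤ μ) (hα : ∀ i, p.α i ∈ Set.Ioc 1 2)
    (hν : 0 ≤ p.nu M) (hv : ∀ i, 0 ≤ p.vPlus n i + p.vMinus n i)
    (hvμ : ∀ i, |p.vPlus n i - p.vMinus n i| * |Real.tan (p.α i / 2 * Real.pi)| ≤
      μ * (p.vPlus n i + p.vMinus n i)) :
    IsSectorial (Matrix.toBilin' (p.coeffMatrix n M)) μ := by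
  rw [coeffMatrix_eq_kronSum]
  refine isSectorial_toBilin'_kronSum hν hμ fun i => ?_
  rw [toBilin'_smul_add_smul_transpose]
  exact (isSectorial_toBilin'_grunwaldMatrix (hα i) (n i)).smul_add_smul_flip (hv i) (hvμ i)

section PosDef

variable (hα : ∀ i, p.α i ∈ Set.Icc 1 2) (hv : ∀ i, 0 ≤ p.vPlus n i + p.vMinus n i)
  (hν : 0 < p.nu M)
include hα hv hν

theorem posDef_tauPrecond : (p.tauPrecond n M).PosDef := by
  rw [tauPrecond_eq_kronSum]
  exact posDef_kronSum hν fun i => (posSemidef_tau_symmPart_grunwaldMatrix (hα i) (n i)).smul (hv i)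

theorem posDef_symmPart_coeffMatrix_sub :
    (symmPart (p.coeffMatrix n M) - (1 / 2 : ℝ) • p.tauPrecond n M).PosDef := by
  rw [symmPart_coeffMatrix, tauPrecond_eq_kronSum, smul_kronSum, kronSum_sub]
  refine posDef_kronSum (by linarith) fun i => ?_
  convert (posSemidef_two_smul_symmPart_grunwaldMatrix_sub_tau (hα i) (n i)).smul
    (div_nonneg (hv i) two_pos.le) using 1
  simp only [Pi.sub_apply, Pi.smul_apply]
  module

theorem posDef_smul_tauPrecond_sub :
    ((3 / 2 : ℝ) • p.tauPrecond n M - symmPart (p.coeffMatrix n M)).PosDef := by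
  rw [symmPart_coeffMatrix, tauPrecond_eq_kronSum, smul_kronSum, kronSum_sub]
  refine posDef_kronSum (by linarith) fun i => ?_
  convert (posSemidef_three_smul_tau_symmPart_grunwaldMatrix_sub (hα i) (n i)).smul
    (div_nonneg (hv i) two_pos.le) using 1
  simp only [Pi.sub_apply, Pi.smul_apply]
  module

end PosDef

end Problem

end Problem

end FracDiff

end

open FracDiff FracDiff.Problem in
theorem mainTheorem9_general (d : ℕ) (hd : 1 ≤ d) (α dPlus dMinus : Fin d → ℝ)
    (hα : ∀ i, 1 < α i ∧ α i ≤ 2) (hsum : ∀ i, 0 < dPlus i + dMinus i) :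
    ∃ ε : ℝ, 0 ≤ ε ∧ ε ≤ FracDiff.epsBound α dPlus dMinus ∧
      (0 < FracDiff.epsBound α dPlus dMinus → ε < FracDiff.epsBound α dPlus dMinus) ∧
      ∀ (p : FracDiff.Problem d) (n : Fin d → ℕ) (M : ℕ),
        p.α = α → p.dPlus = dPlus → p.dMinus = dMinus →
        (∀ i, p.a i < p.b i) → 0 < p.T → 1 ≤ M →
        IsUnit (p.tauPrecond n M).det ∧
        ∀ z : ℂ,
          Module.End.HasEigenvalue
            (Matrix.toLin' (((p.tauPrecond n M)⁻¹ * FracDiff.multiAntiIdentity n *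
              p.coeffMatrix n M).map (fun x : ℝ => (x : ℂ)))) z →
          ∃ x : ℝ, z = (x : ℂ) ∧
            x ∈ Set.Ioo (-(3 / 2 * (1 + ε))) (-(1 / 2)) ∪ Set.Ioo (1 / 2) (3 / 2 * (1 + ε)) := by
  have hμ : 0 ≤ epsBound α dPlus dMinus := epsBound_nonneg α (hsum ⟨0, hd⟩).le
  refine ⟨√(1 + epsBound α dPlus dMinus ^ 2) - 1,
    sub_nonneg.2 (Real.one_le_sqrt.2 (le_add_of_nonneg_right (sq_nonneg _))),
    sub_le_iff_le_add'.2 (sqrt_one_add_sq_le hμ),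
    fun hpos => sub_lt_iff_lt_add'.2 (sqrt_one_add_sq_lt hpos), ?_⟩
  rintro p n M rfl rfl rfl hab hT hM
  have hν : 0 < p.nu M := nu_pos hT hM
  have hv (i : Fin d) : 0 ≤ p.vPlus n i + p.vMinus n i :=
    vPlus_add_vMinus_nonneg (hab i) (hsum i).le
  have hα' (i : Fin d) : p.α i ∈ Set.Icc 1 2 := ⟨(hα i).1.le, (hα i).2⟩
  have hP : (p.tauPrecond n M).PosDef := posDef_tauPrecond hα' hv hν
  have hA : IsSectorial (Matrix.toBilin' (p.coeffMatrix n M)) _ :=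
    isSectorial_toBilin'_coeffMatrix hμ hα hν.le hv fun i =>
      abs_vPlus_sub_vMinus_mul_le (hab i) (hsum i)
  refine ⟨(Matrix.isUnit_iff_isUnit_det _).1 hP.isUnit, fun z hz => ?_⟩
  obtain ⟨l, hzl, hl⟩ := exists_real_abs_mem_Ioo_of_hasEigenvalue (multiAntiIdentity_mul_self n)
    (multiAntiIdentity_transpose n) hP (multiAntiIdentity_mul_tauPrecond p n M)
    (multiAntiIdentity_mul_coeffMatrix p n M) (posDef_symmPart_coeffMatrix_sub hα' hv hν)
    (posDef_smul_tauPrecond_sub hα' hv hν) hA hz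
  rw [add_sub_cancel]
  exact ⟨l, hzl, mem_Ioo_union_Ioo_of_abs_mem_Ioo hl⟩

theorem mainTheorem9 (d : ℕ) (hd : 1 ≤ d) (α dPlus dMinus : Fin d → ℝ)
    (hα : ∀ i, 1 < α i ∧ α i < 2)
    (hPlus : ∀ i, 0 ≤ dPlus i) (hMinus : ∀ i, 0 ≤ dMinus i)
    (hsum : ∀ i, 0 < dPlus i + dMinus i) :
    ∃ ε : ℝ, 0 ≤ ε ∧ ε ≤ FracDiff.epsBound α dPlus dMinus ∧
      (0 < FracDiff.epsBound α dPlus dMinus → ε < FracDiff.epsBound α dPlus dMinus) ∧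
      ∀ (p : FracDiff.Problem d) (n : Fin d → ℕ) (M : ℕ),
        p.α = α → p.dPlus = dPlus → p.dMinus = dMinus →
        (∀ i, p.a i < p.b i) → 0 < p.T → (∀ i, 1 ≤ n i) → 1 ≤ M →
        IsUnit (p.tauPrecond n M).det ∧
        ∀ z : ℂ,
          Module.End.HasEigenvalue
            (Matrix.toLin' (((p.tauPrecond n M)⁻¹ * FracDiff.multiAntiIdentity n *
              p.coeffMatrix n M).map (fun x : ℝ => (x : ℂ)))) z →
          ∃ x : ℝ, z = (x : ℂ) ∧
            x ∈ Set.Ioo (-(3 / 2 * (1 + ε))) (-(1 / 2)) ∪ Set.Ioo (1 / 2) (3 / 2 * (1 + ε)) := by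
  obtain ⟨ε, hε, hle, hlt, h⟩ := mainTheorem9_general d hd α dPlus dMinus
    (fun i => ⟨(hα i).1, (hα i).2.le⟩) hsum
  exact ⟨ε, hε, hle, hlt, fun p n M hpα hp hm hab hT _ hM => h p n M hpα hp hm hab hT hM⟩
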